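/- **Theorem (dihedral groups).** Let $m\ge 2$ be a power of $2$, let $G=D_{2m}$ be the dihedral group of order $2m$, and let $\bar\rho\colon G\to \mathrm{GL}_2(\mathbf F_2)$ be the trivial representation, with associated residual determinant $\bar{\mathbf D}=\det\circ\bar\rho$. For a commutative ring $A$, a $2$-dimensional determinant of $G$ over $A$ is a polynomial law $\mathbf D\colon A[G]\to A$ (over $A$) which is multiplicative and homogeneous of degree $2$. Let $\mathcal C$ be the category of Artinian local $\mathbf Z_2$-algebras with residue field $\mathbf F_2$. * Let $R^{\square}$, with universal lifting $\rho^{\mathrm{univ}}\colon G\to\mathrm{GL}_2(R^{\square})$, be the complete local Noetherian $\mathbf Z_2$-algebra with residue field $\mathbf F_2$ pro-representing the functor on $\mathcal C$ that sends $A$ to the set of homomorphisms $G\to\mathrm{GL}_2(A)$ that reduce to $\bar\rho$ modulo $\mathfrak m_A$. Let $R^{\mathrm{coeff}}\subset R^{\square}$ be the $\mathbf Z_2$-subalgebra generated by the coefficients of the characteristic polynomials of the matrices $\rho^{\mathrm{univ}}(g)$, $g\in G$. * Let $R^{\mathrm{ps}}$, with universal determinant $\mathbf D^{\mathrm{univ}}\colon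 R^{\mathrm{ps}}[G]\to R^{\mathrm{ps}}$, be the complete local Noetherian $\mathbf Z_2$-algebra with residue field $\mathbf F_2$ pro-representing the functor on $\mathcal C$ that sends $A$ to the set of $2$-dimensional determinants $\mathbf D$ of $G$ over $A$ with $\mathbf D\otimes_A\mathbf F_2=\bar{\mathbf D}$. Then $R^{\square}$ and $R^{\mathrm{ps}}$ exist, and there is an isomorphism of $\mathbf Z_2$-algebras $R^{\mathrm{ps}}\cong R^{\mathrm{coeff}}$ such that the base change of $\mathbf D^{\mathrm{univ}}$ along $R^{\mathrm{ps}}\cong R^{\mathrm{coeff}}\subset R^{\square}$ is $\det\circ\rho^{\mathrm{univ}}$. Moreover, as $\mathbf Z_2$-modules, $$R^{\mathrm{ps}}\;\cong\; R^{\mathrm{coeff}}\;\cong\;\mathbf Z_2^{\,s}\qquad\text{with } s=\frac{m+18}{2}>0 .$$ -/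

import Mathlib

open scoped TensorProduct

noncomputable section

namespace PseudoDef

/-! Groups are discrete (the theorem is about a finite group), so continuity conditions on
representations and determinants are automatically satisfied. -/

/-- A determinant of `G` over `A` of dimension `d`: a polynomial law `A[G] → A` that is
multiplicative and homogeneous of degree `d`. -/
structure Determinant (A : Type) [CommRing A] (G : Type) [Group G] (d : ℕ) where
  law : MonoidAlgebra A G →ₚₗ[A] A
  map_one : ∀ (S : Type) [CommRing S] [Algebra A S],
    law.toFun' S (1 : S ⊗[A] MonoidAlgebra A G) = 1
  map_mul : ∀ (S : Type) [CommRing S] [Algebra A S] (x y : S ⊗[A] MonoidAlgebra A G),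
    law.toFun' S (x * y) = law.toFun' S x * law.toFun' S y
  map_smul : ∀ (S : Type) [CommRing S] [Algebra A S] (b : S) (x : S ⊗[A] MonoidAlgebra A G),
    law.toFun' S (b • x) = b ^ d • law.toFun' S x

/-- The value in `S` of a determinant over `A` at the element `∑ x_g g` of `S[G] = S ⊗ A[G]`,
where `S` is an `A`-algebra through `φ`, and `S ⊗ A` is identified with `S`. -/
def Determinant.eval {A : Type} [CommRing A] {G : Type} [Group G] {d : ℕ}
    (D : Determinant A G d) {S : Type} [CommRing S] (φ : A →+* S) (x : G →₀ S) : S :=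
  letI := φ.toAlgebra
  TensorProduct.rid A S
    (D.law.toFun' S (x.sum fun g s => s ⊗ₜ[A] MonoidAlgebra.of A G g))

/-- `D'` is the base change `D ⊗_A A'` of `D` along `φ : A → A'`: for every `A'`-algebra `B`
the maps `B[G] → B` that belong to `D'` and to `D` coincide. -/
def Determinant.IsBaseChange {A A' : Type} [CommRing A] [CommRing A'] {G : Type} [Group G]
    {d : ℕ} (φ : A →+* A') (D : Determinant A G d) (D' : Determinant A' G d) : Prop :=
  ∀ (B : Type) [CommRing B] (f : A' →+* B) (x : G →₀ B), D'.eval f x = D.eval (f.comp φ) x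

section ofRep

variable {A : Type} [CommRing A] {G : Type} [Group G] {d : ℕ}

/-- The `S`-linear extension `S ⊗ A[G] → M_d(S)` of a representation over `A`. -/
def extendRep (ρ : G →* GL (Fin d) A) (S : Type) [CommSemiring S] [Algebra A S] :
    S ⊗[A] MonoidAlgebra A G →ₐ[S] Matrix (Fin d) (Fin d) S :=
  Algebra.TensorProduct.lift (Algebra.ofId S (Matrix (Fin d) (Fin d) S))
    ((Algebra.ofId A S).mapMatrix.comp
      (MonoidAlgebra.lift A (Matrix (Fin d) (Fin d) A) G
        ((Units.coeHom (Matrix (Fin d) (Fin d) A)).comp ρ)))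
    (fun s _ => by rw [Algebra.ofId_apply]; exact Algebra.commute_algebraMap_left s _)

/-- An algebra over a commutative ring is a commutative ring; `Matrix.det` needs the ring
structure. -/
def detOver (A S : Type) [CommRing A] [CommSemiring S] [Algebra A S]
    (M : Matrix (Fin d) (Fin d) S) : S :=
  letI := (algebraMap A S).commSemiringToCommRing
  M.det

theorem detOver_eq {S : Type} [CommRing S] [Algebra A S] (M : Matrix (Fin d) (Fin d) S) :
    detOver A S M = M.det := by
  have h : (algebraMap A S).commSemiringToCommRing = ‹CommRing S› :=
    CommRing.ext rfl rfl
  unfold detOver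
  rw [h]

theorem detOver_map {S S' : Type} [CommSemiring S] [Algebra A S] [CommSemiring S']
    [Algebra A S'] (φ : S →ₐ[A] S') (M : Matrix (Fin d) (Fin d) S) :
    detOver A S' (M.map φ) = φ (detOver A S M) := by
  let _ : CommRing S := (algebraMap A S).commSemiringToCommRing
  let _ : CommRing S' := (algebraMap A S').commSemiringToCommRing
  exact (RingHom.map_det (φ : S →+* S') M).symm

theorem extendRep_tmul (ρ : G →* GL (Fin d) A) {S : Type} [CommSemiring S] [Algebra A S]
    (s : S) (x : MonoidAlgebra A G) (i j : Fin d) :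
    extendRep ρ S (s ⊗ₜ[A] x) i j = s * algebraMap A S (MonoidAlgebra.lift A
      (Matrix (Fin d) (Fin d) A) G ((Units.coeHom (Matrix (Fin d) (Fin d) A)).comp ρ) x i j) := by
  rw [extendRep, Algebra.TensorProduct.lift_tmul, Algebra.ofId_apply, ← Algebra.smul_def,
    Matrix.smul_apply, smul_eq_mul]
  rfl

theorem extendRep_rTensor (ρ : G →* GL (Fin d) A) {S S' : Type} [CommSemiring S] [Algebra A S]
    [CommSemiring S'] [Algebra A S'] (φ : S →ₐ[A] S') (z : S ⊗[A] MonoidAlgebra A G) :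
    extendRep ρ S' (φ.toLinearMap.rTensor (MonoidAlgebra A G) z) = (extendRep ρ S z).map φ := by
  induction z with
  | zero => ext; simp
  | add x y hx hy =>
    rw [map_add, map_add, hx, hy, map_add]
    ext; simp
  | tmul s x =>
    ext i j
    rw [LinearMap.rTensor_tmul, Matrix.map_apply, extendRep_tmul, extendRep_tmul, map_mul,
      AlgHom.commutes, AlgHom.toLinearMap_apply]

/-- The determinant `det ∘ ρ` attached to a representation `ρ`. -/
def Determinant.ofRep (ρ : G →* GL (Fin d) A) : Determinant A G d where
  law :=
    { toFun' := fun S _ _ z => detOver A S (extendRep ρ S z) ⊗ₜ[A] 1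
      isCompat' := by
        intro S _ _ S' _ _ φ
        funext z
        rw [Function.comp_apply, Function.comp_apply, LinearMap.rTensor_tmul, extendRep_rTensor,
          detOver_map, AlgHom.toLinearMap_apply] }
  map_one := by
    intro S _ _
    change detOver A S (extendRep ρ S 1) ⊗ₜ[A] 1 = 1
    rw [_root_.map_one, detOver_eq, Matrix.det_one, Algebra.TensorProduct.one_def]
  map_mul := by
    intro S _ _ x y
    simp [detOver_eq, Algebra.TensorProduct.tmul_mul_tmul]
  map_smul := by
    intro S _ _ b x
    simp [detOver_eq, TensorProduct.smul_tmul']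

end ofRep

/-- `ρ`, with values in the local ring `A`, is a lifting of the residual representation `ρbar`.
The ring homomorphism `π` to the field `ZMod p` is the identification of the residue field
of `A` with `ZMod p`. -/
def IsLifting {p : ℕ} {G : Type} [Group G] {d : ℕ} (ρbar : G →* GL (Fin d) (ZMod p))
    {A : Type} [CommRing A] (π : A →+* ZMod p) (ρ : G →* GL (Fin d) A) : Prop :=
  (Matrix.GeneralLinearGroup.map π).comp ρ = ρbar

/-- A universal framed deformation ring of `ρbar`, with its universal lifting: a complete
Noetherian local `ℤ_p`-algebra with residue field `𝔽_p` that pro-represents the functor of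
liftings of `ρbar` to Artinian local `ℤ_p`-algebras with residue field `𝔽_p`.
(A `ℤ_p`-algebra homomorphism between such rings is automatically local and compatible with the
maps to `𝔽_p`.) -/
structure LiftingRing (p : ℕ) [Fact p.Prime] {G : Type} [Group G] {d : ℕ}
    (ρbar : G →* GL (Fin d) (ZMod p)) where
  R : Type
  [commRing : CommRing R]
  [isLocalRing : IsLocalRing R]
  [isNoetherianRing : IsNoetherianRing R]
  [algebra : Algebra ℤ_[p] R]
  [isAdicComplete : IsAdicComplete (IsLocalRing.maximalIdeal R) R]
  π : R →+* ZMod p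
  ρ : G →* GL (Fin d) R
  isLifting : IsLifting ρbar π ρ
  universal : ∀ (A : Type) [CommRing A] [IsLocalRing A] [IsArtinianRing A] [Algebra ℤ_[p] A]
    (πA : A →+* ZMod p) (ρA : G →* GL (Fin d) A), IsLifting ρbar πA ρA →
    ∃! φ : R →ₐ[ℤ_[p]] A, (Matrix.GeneralLinearGroup.map (φ : R →+* A)).comp ρ = ρA

attribute [instance] LiftingRing.commRing LiftingRing.isLocalRing LiftingRing.isNoetherianRing
  LiftingRing.algebra LiftingRing.isAdicComplete

/-- The coefficient ring: the `ℤ_p`-subalgebra of the universal framed deformation ring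
generated by the coefficients of the characteristic polynomials of the `ρ g`. -/
def LiftingRing.coeffRing {p : ℕ} [Fact p.Prime] {G : Type} [Group G] {d : ℕ}
    {ρbar : G →* GL (Fin d) (ZMod p)} (L : LiftingRing p ρbar) : Subalgebra ℤ_[p] L.R :=
  Algebra.adjoin ℤ_[p]
    {c | ∃ (g : G) (i : ℕ), c = (L.ρ g : Matrix (Fin d) (Fin d) L.R).charpoly.coeff i}

/-- A universal pseudodeformation ring of the residual determinant `Dbar`, with its universal
determinant: a complete Noetherian local `ℤ_p`-algebra with residue field `𝔽_p` that
pro-represents the functor sending an Artinian local `ℤ_p`-algebra `A` with residue field `𝔽_p`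
to the set of determinants `A[G] → A` whose base change to `𝔽_p` is `Dbar`. -/
structure PseudoDeformationRing (p : ℕ) [Fact p.Prime] {G : Type} [Group G] {d : ℕ}
    (Dbar : Determinant (ZMod p) G d) where
  R : Type
  [commRing : CommRing R]
  [isLocalRing : IsLocalRing R]
  [isNoetherianRing : IsNoetherianRing R]
  [algebra : Algebra ℤ_[p] R]
  [isAdicComplete : IsAdicComplete (IsLocalRing.maximalIdeal R) R]
  π : R →+* ZMod p
  D : Determinant R G d
  isDeformation : D.IsBaseChange π Dbar
  universal : ∀ (A : Type) [CommRing A] [IsLocalRing A] [IsArtinianRing A] [Algebra ℤ_[p] A]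
    (πA : A →+* ZMod p) (DA : Determinant A G d), DA.IsBaseChange πA Dbar →
    ∃! φ : R →ₐ[ℤ_[p]] A, D.IsBaseChange (φ : R →+* A) DA

attribute [instance] PseudoDeformationRing.commRing PseudoDeformationRing.isLocalRing
  PseudoDeformationRing.isNoetherianRing PseudoDeformationRing.algebra
  PseudoDeformationRing.isAdicComplete

end PseudoDef

end

noncomputable section

namespace PseudoDef

/-! Write `m = 2M`, and let `a = sr 0`, `b = sr 1`, so that `ab = r 1` has order `2M`. A
two-dimensional determinant of a finite group is a quadratic form on the group ring. Its diagonal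
consists of the norms `nm g`, and its polar form at `(g, h)` is `tr (g h⁻¹) * nm h`, so traces and
norms determine it. Multiplicativity gives `tr g * tr h = tr (g h) + tr (g h⁻¹) * nm h`. For the
dihedral group everything is therefore a polynomial in the traces `x, y, z` of `a, b, ab` and the
norms `α, β` of `a, b`, and these satisfy the equations of `IsPseudoPoint`.

Let `PseudoRing` be the ring presented by these equations. Rewriting with them shows that `8 + (M +
1)` monomials span it (`PseudoRing.span_monomials`). They are independent because representations
separate them (`normalForm_injective`): the sums of two sign characters, and one generic
representation over `R[u] / (u S_{M-1}(u² + 2))`, with `S` the rescaled Chebyshev polynomial. So the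
ring is free of rank `M + 9 = (m + 18) / 2`, and it embeds in a product of test rings through
liftings of the trivial representation.

This embedding also yields the universal determinant. The determinant of the product of these
liftings has traces and norms in the image of `PseudoRing`, so it descends
(`PseudoRing.exists_determinant`), and no direct check that the equations suffice is required.

Over `ℤ_[2]`, traces and norms of a 2-group are constant modulo the radical of `(2)`. Hence
`PseudoRing` is a complete local ring, and it is the pseudodeformation ring. The framed ring is a
completion of the finitely generated algebra that classifies all representations. A lifting to the
test ring factors through it modulo every power of the maximal ideal, so `PseudoRing` injects into
the framed ring; its image is generated by the traces and norms, that is, by the coefficients of the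
characteristic polynomials. -/

/-- The value at `x` of the quadratic form with coefficient matrix `M`, over an algebra `φ`. -/
def quadEval {A S G : Type} [Fintype G] [CommSemiring A] [CommSemiring S] (M : G → G → A)
    (φ : A →+* S) (x : G → S) : S :=
  ∑ i, ∑ j, φ (M i j) * x i * x j

/-! ### Quadratic forms given by coefficient matrices -/

section quadEval

variable {A S S' G : Type} [Fintype G]

theorem map_quadEval [CommSemiring A] [CommSemiring S] [CommSemiring S'] (M : G → G → A)
    (φ : A →+* S) (ψ : S →+* S') (x : G → S) :
    ψ (quadEval M φ x) = quadEval M (ψ.comp φ) (fun g => ψ (x g)) := by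
  simp [quadEval, map_sum]

theorem quadEval_comp [CommSemiring A] [CommSemiring S] [CommSemiring S'] (M : G → G → A)
    (φ : A →+* S) (ψ : S →+* S') (x : G → S') :
    quadEval (fun i j => φ (M i j)) ψ x = quadEval M (ψ.comp φ) x := by
  simp [quadEval]

theorem quadEval_smul [CommSemiring A] [CommSemiring S] (M : G → G → A)
    (φ : A →+* S) (b : S) (x : G → S) :
    quadEval M φ (b • x) = b ^ 2 * quadEval M φ x := by
  simp only [quadEval, Finset.mul_sum, Pi.smul_apply, smul_eq_mul]
  refine Finset.sum_congr rfl fun i _ => Finset.sum_congr rfl fun j _ => by ring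

theorem quadEval_single [CommSemiring A] [CommSemiring S] [DecidableEq G] (M : G → G → A)
    (φ : A →+* S) (g : G) :
    quadEval M φ (Pi.single g 1) = φ (M g g) := by
  simp [quadEval, Pi.single_apply]

theorem quadEval_add [CommSemiring A] [CommSemiring S] (M : G → G → A)
    (φ : A →+* S) (x y : G → S) :
    quadEval M φ (x + y) = quadEval M φ x + quadEval M φ y +
      ∑ i, ∑ j, φ (M i j + M j i) * x i * y j := by
  have h : ∑ i, ∑ j, φ (M j i) * x i * y j = ∑ i, ∑ j, φ (M i j) * y i * x j := by
    rw [Finset.sum_comm]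
    refine Finset.sum_congr rfl fun i _ => Finset.sum_congr rfl fun j _ => by ring
  simp only [map_add, add_mul, Finset.sum_add_distrib, h]
  simp only [quadEval, ← Finset.sum_add_distrib]
  refine Finset.sum_congr rfl fun i _ => Finset.sum_congr rfl fun j _ => ?_
  simp only [Pi.add_apply]
  ring

/-- A quadratic form is determined by the diagonal and the polar form. -/
theorem quadEval_congr [CommRing A] [CommRing S] [DecidableEq G] {A' : Type} [CommRing A']
    (M : G → G → A) (M' : G → G → A')
    (φ : A →+* S) (φ' : A' →+* S) (hd : ∀ g, φ (M g g) = φ' (M' g g))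
    (hp : ∀ g h, φ (M g h + M h g) = φ' (M' g h + M' h g)) (x : G → S) :
    quadEval M φ x = quadEval M' φ' x := by
  rw [← sub_eq_zero]
  simp only [quadEval, ← Finset.sum_sub_distrib]
  rw [← Finset.sum_product']
  -- Terms at `(i, j)` and `(j, i)` cancel by equality of the polar forms. On the diagonal the polar
  -- form only controls twice the coefficient, so the fixed points of the swap need the separate
  -- hypothesis `hd`.
  refine Finset.sum_involution (fun p _ => (p.2, p.1)) ?_ ?_ (by simp) (by simp)
  · rintro ⟨i, j⟩ -
    have := hp i j
    simp only [map_add] at this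
    linear_combination (x i * x j) * this
  · rintro ⟨i, j⟩ - hne heq
    obtain rfl : j = i := congrArg Prod.fst heq
    exact hne (by simp [hd])

end quadEval

/-- A homogeneous polynomial of degree two is a quadratic form. -/
theorem exists_quadEval_of_isHomogeneous {A G : Type} [Fintype G] [CommRing A]
    {F : MvPolynomial G A} (hF : F.IsHomogeneous 2) :
    ∃ M : G → G → A, F = quadEval M MvPolynomial.C MvPolynomial.X := by
  classical
  have key : ∀ d : G →₀ ℕ, d.degree = 2 → ∀ c : A, ∃ M : G → G → A,
      MvPolynomial.monomial d c = quadEval M MvPolynomial.C MvPolynomial.X := by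
    intro d hd c
    obtain ⟨i, hi⟩ : ∃ i, d i ≠ 0 := by
      by_contra! h
      have : d = 0 := Finsupp.ext h
      simp [this] at hd
    obtain ⟨e, rfl⟩ : ∃ e, d = Finsupp.single i 1 + e :=
      ⟨d - Finsupp.single i 1, (add_tsub_cancel_of_le (by simpa using Nat.one_le_iff_ne_zero.2 hi)).symm⟩
    have he : e.degree = 1 := by
      rw [map_add, Finsupp.degree_single] at hd
      omega
    obtain ⟨j, hj⟩ : ∃ j, e = Finsupp.single j 1 := by
      obtain ⟨j, hj⟩ : ∃ j, e j ≠ 0 := by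
        by_contra! h
        have : e = 0 := Finsupp.ext h
        simp [this] at he
      refine ⟨j, ?_⟩
      obtain ⟨e', rfl⟩ : ∃ e', e = Finsupp.single j 1 + e' :=
        ⟨e - Finsupp.single j 1,
          (add_tsub_cancel_of_le (by simpa using Nat.one_le_iff_ne_zero.2 hj)).symm⟩
      rw [map_add, Finsupp.degree_single] at he
      rw [(Finsupp.degree_eq_zero_iff e').1 (by omega), add_zero]
    refine ⟨fun k l => if k = i ∧ l = j then c else 0, ?_⟩
    subst hj
    have : ∀ k l : G, (MvPolynomial.C (if k = i ∧ l = j then c else 0) *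
        MvPolynomial.X k * MvPolynomial.X l : MvPolynomial G A) =
        if k = i then (if l = j then MvPolynomial.C c * MvPolynomial.X k * MvPolynomial.X l else 0)
        else 0 := by
      intro k l
      by_cases hk : k = i <;> by_cases hl : l = j <;> simp [hk, hl]
    simp only [quadEval, this]
    simp [MvPolynomial.monomial_eq, Finsupp.prod_add_index', pow_add, mul_assoc]
  rw [F.as_sum]
  have : ∀ s : Finset (G →₀ ℕ), s ⊆ F.support → ∃ M : G → G → A,
      ∑ v ∈ s, MvPolynomial.monomial v (F.coeff v) = quadEval M MvPolynomial.C MvPolynomial.X := by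
    intro s
    induction s using Finset.induction_on with
    | empty => exact fun _ => ⟨0, by simp [quadEval]⟩
    | insert v s hv ih =>
      intro hs
      obtain ⟨M, hM⟩ := ih ((Finset.subset_insert _ _).trans hs)
      have hv' : v.degree = 2 := by
        have := hF (MvPolynomial.mem_support_iff.1 (hs (Finset.mem_insert_self v s)))
        rw [Finsupp.degree_eq_weight_one]
        exact this
      obtain ⟨N, hN⟩ := key v hv' (F.coeff v)
      refine ⟨N + M, ?_⟩
      rw [Finset.sum_insert hv, hM, hN]
      simp [quadEval, add_mul, Finset.sum_add_distrib]
  exact this _ subset_rfl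

/-- The inclusion `S[G] → S ⊗ A[G]`. -/
def toTensor (A S G : Type) [CommRing A] [CommRing S] [Algebra A S] [Group G] :
    MonoidAlgebra S G →ₐ[S] S ⊗[A] MonoidAlgebra A G :=
  MonoidAlgebra.lift S (S ⊗[A] MonoidAlgebra A G) G
    ((Algebra.TensorProduct.includeRight :
      _ →ₐ[A] S ⊗[A] MonoidAlgebra A G).toMonoidHom.comp (MonoidAlgebra.of A G))

theorem toTensor_apply (A : Type) {S G : Type} [CommRing A] [CommRing S] [Algebra A S] [Group G]
    (x : MonoidAlgebra S G) :
    toTensor A S G x = x.coeff.sum fun g s => s ⊗ₜ[A] MonoidAlgebra.of A G g := by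
  rw [toTensor, MonoidAlgebra.lift_apply]
  simp [TensorProduct.smul_tmul']

/-- The coordinates of an element of `S ⊗ A[G]`. -/
def ofTensor (A S G : Type) [CommRing A] [CommSemiring S] [Algebra A S] [Group G] :
    S ⊗[A] MonoidAlgebra A G →ₐ[S] MonoidAlgebra S G :=
  Algebra.TensorProduct.lift (Algebra.ofId S _) (MonoidAlgebra.mapAlgHom G (Algebra.ofId A S))
    (fun s _ => by rw [Algebra.ofId_apply]; exact Algebra.commute_algebraMap_left s _)

theorem ofTensor_tmul {A S G : Type} [CommRing A] [CommSemiring S] [Algebra A S] [Group G]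
    (s : S) (x : MonoidAlgebra A G) (g : G) :
    (ofTensor A S G (s ⊗ₜ x)).coeff g = s * algebraMap A S (x.coeff g) := by
  rw [ofTensor, Algebra.TensorProduct.lift_tmul, Algebra.ofId_apply, ← Algebra.smul_def]
  simp [Algebra.ofId_apply]

theorem ofTensor_toTensor {A S G : Type} [CommRing A] [CommRing S] [Algebra A S] [Group G]
    (x : MonoidAlgebra S G) : ofTensor A S G (toTensor A S G x) = x := by
  have : (ofTensor A S G).comp (toTensor A S G) = AlgHom.id S _ := by
    apply MonoidAlgebra.algHom_ext
    · intro g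
      ext h
      rw [AlgHom.comp_apply, toTensor_apply]
      by_cases hg : g = h <;> simp [ofTensor_tmul, hg]
    · exact Subsingleton.elim _ _
  exact DFunLike.congr_fun this x

theorem ofTensor_rTensor {A S S' G : Type} [CommRing A] [CommSemiring S] [Algebra A S]
    [CommSemiring S'] [Algebra A S'] [Group G] (φ : S →ₐ[A] S') (z : S ⊗[A] MonoidAlgebra A G)
    (g : G) :
    (ofTensor A S' G (φ.toLinearMap.rTensor (MonoidAlgebra A G) z)).coeff g =
      φ ((ofTensor A S G z).coeff g) := by
  induction z with
  | zero => simp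
  | add x y hx hy => simp only [map_add, MonoidAlgebra.coeff_add, Finsupp.add_apply, hx, hy]
  | tmul s x =>
    rw [LinearMap.rTensor_tmul, ofTensor_tmul, ofTensor_tmul, map_mul, AlgHom.commutes,
      AlgHom.toLinearMap_apply]

/-! ### Determinants evaluated on group rings -/

section eval

variable {A : Type} [CommRing A] {G : Type} [Group G] {d : ℕ} (D : Determinant A G d)
  {S : Type} [CommRing S] (φ : A →+* S)

theorem Determinant.eval_eq_toTensor (x : MonoidAlgebra S G) :
    letI := φ.toAlgebra
    D.eval φ x.coeff = TensorProduct.rid A S (D.law.toFun' S (toTensor A S G x)) := by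
  let _ := φ.toAlgebra
  rw [toTensor_apply]
  rfl

theorem Determinant.eval_one : D.eval φ (1 : MonoidAlgebra S G).coeff = 1 := by
  let _ := φ.toAlgebra
  rw [D.eval_eq_toTensor, _root_.map_one, D.map_one]
  exact _root_.map_one (Algebra.TensorProduct.rid A A S)

theorem Determinant.eval_mul (x y : MonoidAlgebra S G) :
    D.eval φ (x * y).coeff = D.eval φ x.coeff * D.eval φ y.coeff := by
  let _ := φ.toAlgebra
  rw [D.eval_eq_toTensor, D.eval_eq_toTensor, D.eval_eq_toTensor, _root_.map_mul, D.map_mul]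
  exact _root_.map_mul (Algebra.TensorProduct.rid A A S) _ _

theorem Determinant.eval_smul (b : S) (x : MonoidAlgebra S G) :
    D.eval φ (b • x).coeff = b ^ d * D.eval φ x.coeff := by
  let _ := φ.toAlgebra
  rw [D.eval_eq_toTensor, D.eval_eq_toTensor, _root_.map_smul, D.map_smul]
  exact _root_.map_smul (Algebra.TensorProduct.rid A S S) _ _

/-- This is the compatibility of the polynomial law with algebra maps, applied to `ψ` after `S'` is
made an `A`-algebra through `ψ.comp φ`. -/
theorem Determinant.eval_map {S' : Type} [CommRing S'] (ψ : S →+* S') (x : G →₀ S) :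
    D.eval (ψ.comp φ) (x.mapRange ψ ψ.map_zero) = ψ (D.eval φ x) := by
  let _ := φ.toAlgebra
  let _ := (ψ.comp φ).toAlgebra
  let ψ' : S →ₐ[A] S' := { ψ with commutes' := fun _ => rfl }
  have h := D.law.isCompat_apply' ψ' (x.sum fun g s => s ⊗ₜ[A] MonoidAlgebra.of A G g)
  have h1 : ψ'.toLinearMap.rTensor (MonoidAlgebra A G)
      (x.sum fun g s => s ⊗ₜ[A] MonoidAlgebra.of A G g) =
      (x.mapRange ψ ψ.map_zero).sum fun g s => s ⊗ₜ[A] MonoidAlgebra.of A G g := by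
    rw [Finsupp.sum_mapRange_index (by simp), Finsupp.sum, map_sum]
    rfl
  rw [h1] at h
  change TensorProduct.rid A S' (D.law.toFun' S' _) = ψ (TensorProduct.rid A S (D.law.toFun' S _))
  rw [← h]
  generalize D.law.toFun' S _ = z
  induction z with
  | zero => simp
  | add x y hx hy => simp only [map_add, hx, hy]
  | tmul s a =>
    simp only [LinearMap.rTensor_tmul, TensorProduct.rid_tmul, Algebra.smul_def]
    exact ((_root_.map_mul ψ' (algebraMap A S a) s).trans (by rw [ψ'.commutes]; rfl)).symm

end eval

/-- Substituting `T * X i` for `X i` multiplies the component of degree `k` by `T ^ k`, so the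
coefficient of `T ^ n` in the result is the component of degree `n`. Under the hypothesis this
coefficient is `F` itself. -/
theorem isHomogeneous_of_map_eq {A σ : Type} [CommRing A] {F : MvPolynomial σ A} {n : ℕ}
    (h : MvPolynomial.aeval (fun i => Polynomial.X * Polynomial.C (MvPolynomial.X i)) F =
      Polynomial.X ^ n * Polynomial.C F) : F.IsHomogeneous n := by
  classical
  have key : ∀ (P : MvPolynomial σ A) (k : ℕ),
      (MvPolynomial.aeval (fun i => (Polynomial.X * Polynomial.C (MvPolynomial.X i) :
        Polynomial (MvPolynomial σ A))) P).coeff k =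
        MvPolynomial.homogeneousComponent k P := by
    intro P k
    induction P using MvPolynomial.induction_on' with
    | add p q hp hq => simp only [map_add, Polynomial.coeff_add, hp, hq]
    | monomial d a =>
      rw [MvPolynomial.aeval_monomial]
      have : (d.prod fun i e => (Polynomial.X * Polynomial.C (MvPolynomial.X i) :
          Polynomial (MvPolynomial σ A)) ^ e) =
          Polynomial.C (MvPolynomial.monomial d 1) * Polynomial.X ^ d.degree := by
        simp only [mul_pow, Finsupp.prod, Finset.prod_mul_distrib, Finset.prod_pow_eq_pow_sum]
        rw [mul_comm, MvPolynomial.monomial_eq, Finsupp.degree_apply, map_one, one_mul,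
          Finsupp.prod, map_prod]
        simp only [map_pow]
      rw [this, IsScalarTower.algebraMap_apply A (MvPolynomial σ A) (Polynomial _),
        Polynomial.algebraMap_eq, MvPolynomial.algebraMap_eq, ← mul_assoc, ← map_mul,
        Polynomial.coeff_C_mul_X_pow, MvPolynomial.C_mul_monomial, mul_one]
      by_cases hk : k = d.degree
      · rw [if_pos hk, MvPolynomial.homogeneousComponent_of_mem
          (MvPolynomial.isHomogeneous_monomial a hk.symm), if_pos rfl]
      · rw [if_neg hk, MvPolynomial.homogeneousComponent_of_mem
          (MvPolynomial.isHomogeneous_monomial a rfl), if_neg hk]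
  have h2 := key F n
  rw [h, mul_comm, Polynomial.coeff_C_mul, Polynomial.coeff_X_pow, if_pos rfl, mul_one] at h2
  rw [h2]
  exact MvPolynomial.homogeneousComponent_isHomogeneous n F

/-! ### Traces, norms and the polar form -/

section

variable {A : Type} [CommRing A] {G : Type} [Group G] (D : Determinant A G 2)

/-- The determinant of a group element. -/
def Determinant.nm (g : G) : A := D.eval (RingHom.id A) (Finsupp.single g 1)

/-- The trace of a group element. -/
def Determinant.tr (g : G) : A :=
  D.eval (RingHom.id A) (Finsupp.single g 1 + Finsupp.single 1 1) - D.nm g - D.nm 1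

/-- The polar form of a two-dimensional determinant. -/
def Determinant.polar (x y : MonoidAlgebra A G) : A :=
  D.eval (RingHom.id A) (x + y).coeff - D.eval (RingHom.id A) x.coeff -
    D.eval (RingHom.id A) y.coeff

theorem Determinant.tr_eq_polar (g : G) :
    D.tr g = D.polar (MonoidAlgebra.single g 1) (MonoidAlgebra.single 1 1) := by
  simp [tr, polar, nm]

theorem Determinant.polar_comm (x y : MonoidAlgebra A G) : D.polar x y = D.polar y x := by
  rw [polar, polar, add_comm]; ring

theorem Determinant.polar_mul_right (x y z : MonoidAlgebra A G) :
    D.polar (x * z) (y * z) = D.polar x y * D.eval (RingHom.id A) z.coeff := by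
  simp only [polar, ← add_mul, eval_mul, sub_mul]

theorem Determinant.polar_mul_left (x y z : MonoidAlgebra A G) :
    D.polar (z * x) (z * y) = D.eval (RingHom.id A) z.coeff * D.polar x y := by
  simp only [polar, ← mul_add, eval_mul, mul_sub]

theorem Determinant.polar_single (g h : G) :
    D.polar (MonoidAlgebra.single g 1) (MonoidAlgebra.single h 1) = D.tr (g * h⁻¹) * D.nm h := by
  rw [tr_eq_polar, nm]
  have := D.polar_mul_right (MonoidAlgebra.single (g * h⁻¹) 1) (MonoidAlgebra.single 1 1)
    (MonoidAlgebra.single h 1)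
  simpa [MonoidAlgebra.single_mul_single] using this

theorem Determinant.nm_one : D.nm 1 = 1 := D.eval_one (RingHom.id A)

theorem Determinant.nm_mul (g h : G) : D.nm (g * h) = D.nm g * D.nm h := by
  have := D.eval_mul (RingHom.id A) (MonoidAlgebra.single g 1) (MonoidAlgebra.single h 1)
  simpa [MonoidAlgebra.single_mul_single, nm] using this

theorem Determinant.tr_one : D.tr 1 = 2 := by
  have h := D.eval_smul (RingHom.id A) 2 (MonoidAlgebra.single 1 1)
  have h1 := D.nm_one
  rw [nm] at h1
  rw [tr, nm, h1]
  simp only [two_smul, MonoidAlgebra.coeff_add, MonoidAlgebra.coeff_single, h1] at h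
  rw [h]
  ring

/-- Left and right translation by `g` both scale the polar form by `nm g`. Applied to the pair `(h,
g⁻¹)` they give the pairs `(g h, 1)` and `(h g, 1)`. -/
theorem Determinant.tr_mul_comm (g h : G) : D.tr (g * h) = D.tr (h * g) := by
  have h1 := D.polar_mul_left (MonoidAlgebra.single h 1) (MonoidAlgebra.single g⁻¹ 1)
    (MonoidAlgebra.single g 1)
  have h2 := D.polar_mul_right (MonoidAlgebra.single h 1) (MonoidAlgebra.single g⁻¹ 1)
    (MonoidAlgebra.single g 1)
  simp only [MonoidAlgebra.single_mul_single, mul_one, mul_inv_cancel, inv_mul_cancel,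
    ← tr_eq_polar] at h1 h2
  rw [h1, h2, mul_comm]

variable [Fintype G]

/-- A two-dimensional determinant is given by a quadratic form. -/
theorem Determinant.exists_quadEval : ∃ M : G → G → A, ∀ (S : Type) [CommRing S] (φ : A →+* S)
    (x : G →₀ S), D.eval φ x = quadEval M φ x := by
  -- `X` is the generic element of the group ring. Every value of `D` is a specialization of its
  -- value `F` at `X`, and scaling `X` by a new variable shows that `F` is homogeneous.
  let X : G →₀ MvPolynomial G A := Finsupp.equivFunOnFinite.symm MvPolynomial.X
  let F := D.eval MvPolynomial.C X
  have hF : F.IsHomogeneous 2 := by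
    apply isHomogeneous_of_map_eq
    let ψ : MvPolynomial G A →+* Polynomial (MvPolynomial G A) := RingHomClass.toRingHom
      (MvPolynomial.aeval (R := A) fun i => Polynomial.X * Polynomial.C (MvPolynomial.X i))
    change ψ F = _
    have e1 : ψ.comp MvPolynomial.C = Polynomial.C.comp MvPolynomial.C := by
      ext a : 1
      simp only [ψ, RingHom.comp_apply, RingHom.coe_coe, MvPolynomial.aeval_C]
      rfl
    have e2 : X.mapRange ψ ψ.map_zero =
        ((Polynomial.X : Polynomial (MvPolynomial G A)) • MonoidAlgebra.ofCoeff
          (X.mapRange (Polynomial.C : MvPolynomial G A →+* _) (RingHom.map_zero _))).coeff := by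
      ext1 g
      simp [ψ, X]
    rw [← D.eval_map, e1, e2, D.eval_smul, MonoidAlgebra.coeff_ofCoeff, D.eval_map]
  obtain ⟨M, hM⟩ := exists_quadEval_of_isHomogeneous hF
  refine ⟨M, fun S _ φ x => ?_⟩
  have h1 := D.eval_map MvPolynomial.C (MvPolynomial.eval₂Hom φ x) X
  rw [show D.eval MvPolynomial.C X = F from rfl, hM, map_quadEval] at h1
  have e1 : (MvPolynomial.eval₂Hom φ x).comp MvPolynomial.C = φ := by ext; simp
  have e2 : X.mapRange (MvPolynomial.eval₂Hom φ x) (RingHom.map_zero _) = x := by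
    ext g; simp [X]
  rw [e1, e2] at h1
  simpa using h1

theorem Determinant.polar_eq_of_quadEval {M : G → G → A}
    (hM : ∀ (S : Type) [CommRing S] (φ : A →+* S) (x : G →₀ S), D.eval φ x = quadEval M φ x)
    (x y : MonoidAlgebra A G) :
    D.polar x y = ∑ i, ∑ j, (M i j + M j i) * x.coeff i * y.coeff j := by
  rw [polar, hM, hM, hM, MonoidAlgebra.coeff_add, Finsupp.coe_add, quadEval_add]
  simp only [RingHom.id_apply]
  ring

theorem Determinant.polar_add_left (x x' y : MonoidAlgebra A G) :
    D.polar (x + x') y = D.polar x y + D.polar x' y := by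
  obtain ⟨M, hM⟩ := D.exists_quadEval
  simp only [D.polar_eq_of_quadEval hM, MonoidAlgebra.coeff_add, Finsupp.add_apply, mul_add,
    add_mul, Finset.sum_add_distrib]

theorem Determinant.polar_add_right (x y y' : MonoidAlgebra A G) :
    D.polar x (y + y') = D.polar x y + D.polar x y' := by
  rw [polar_comm, polar_add_left, D.polar_comm y, D.polar_comm y']

/-- The identity `polar (x z) (y z) = polar x y * D z` is quadratic in `z`; this is its
polarization. -/
theorem Determinant.polar_mul_polar (x y z w : MonoidAlgebra A G) :
    D.polar x y * D.polar z w = D.polar (x * z) (y * w) + D.polar (x * w) (y * z) := by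
  have h := D.polar_mul_right x y (z + w)
  rw [mul_add, mul_add, polar_add_left, polar_add_right, polar_add_right, polar_mul_right,
    polar_mul_right] at h
  have : D.polar z w = D.eval (RingHom.id A) (z + w).coeff - D.eval (RingHom.id A) z.coeff -
    D.eval (RingHom.id A) w.coeff := rfl
  rw [this]
  linear_combination -h

/-- The polarized multiplicativity with two entries equal to `1`. It plays the role of the
Cayley–Hamilton theorem: the recurrences for the traces and most relations of `IsPseudoPoint` are
instances of it. -/
theorem Determinant.tr_mul_tr (g h : G) :
    D.tr g * D.tr h = D.tr (g * h) + D.tr (g * h⁻¹) * D.nm h := by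
  have := D.polar_mul_polar (MonoidAlgebra.single g 1) (MonoidAlgebra.single 1 1)
    (MonoidAlgebra.single h 1) (MonoidAlgebra.single 1 1)
  rw [← tr_eq_polar, ← tr_eq_polar] at this
  simp only [MonoidAlgebra.single_mul_single, mul_one, one_mul] at this
  rw [this, ← tr_eq_polar, polar_single]

theorem Determinant.quadEval_diag {M : G → G → A}
    (hM : ∀ (S : Type) [CommRing S] (φ : A →+* S) (x : G →₀ S), D.eval φ x = quadEval M φ x)
    (g : G) : M g g = D.nm g := by
  classical
  rw [nm, hM, Finsupp.single_eq_pi_single, quadEval_single, RingHom.id_apply]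

theorem Determinant.quadEval_polar {M : G → G → A}
    (hM : ∀ (S : Type) [CommRing S] (φ : A →+* S) (x : G →₀ S), D.eval φ x = quadEval M φ x)
    (g h : G) : M g h + M h g = D.tr (g * h⁻¹) * D.nm h := by
  classical
  rw [← polar_single, D.polar_eq_of_quadEval hM]
  simp [Finsupp.single_apply]

/-- The norms are the diagonal of the quadratic form, and traces and norms give its polar form, so
`quadEval_congr` applies. -/
theorem Determinant.isBaseChange_iff {A' : Type} [CommRing A'] (φ : A →+* A')
    (D' : Determinant A' G 2) : D.IsBaseChange φ D' ↔
      (∀ g, φ (D.tr g) = D'.tr g) ∧ ∀ g, φ (D.nm g) = D'.nm g := by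
  classical
  constructor
  · intro h
    have hn : ∀ g, φ (D.nm g) = D'.nm g := fun g => by
      rw [nm, nm, h, ← D.eval_map, RingHom.comp_id, RingHom.id_comp, Finsupp.mapRange_single,
        _root_.map_one]
    refine ⟨fun g => ?_, hn⟩
    rw [tr, tr, map_sub, map_sub, hn, hn, h, ← D.eval_map, RingHom.comp_id, RingHom.id_comp,
      Finsupp.mapRange_add (map_add φ), Finsupp.mapRange_single, Finsupp.mapRange_single,
      _root_.map_one]
  · rintro ⟨ht, hn⟩ B _ f x
    obtain ⟨M, hM⟩ := D.exists_quadEval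
    obtain ⟨M', hM'⟩ := D'.exists_quadEval
    rw [hM, hM']
    refine quadEval_congr _ _ _ _ (fun g => ?_) (fun g h => ?_) x
    · rw [D.quadEval_diag hM, D'.quadEval_diag hM', RingHom.comp_apply, hn]
    · rw [D.quadEval_polar hM, D'.quadEval_polar hM', RingHom.comp_apply, _root_.map_mul, _root_.map_mul φ, ht,
        hn, _root_.map_mul]

end

/-! ### Determinants of representations and descent of determinants -/

section ofRep

variable {A : Type} [CommRing A] {G : Type} [Group G]

theorem Determinant.eval_ofRep [Fintype G] {d : ℕ} (ρ : G →* GL (Fin d) A) {S : Type} [CommRing S]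
    (φ : A →+* S) (x : G →₀ S) :
    (Determinant.ofRep ρ).eval φ x =
      (Matrix.of fun i j => ∑ g, x g * φ ((ρ g : Matrix (Fin d) (Fin d) A) i j)).det := by
  let _ := φ.toAlgebra
  change TensorProduct.rid A S (detOver A S _ ⊗ₜ[A] 1) = _
  rw [TensorProduct.rid_tmul, one_smul, detOver_eq]
  congr 1
  ext i j
  rw [Finsupp.sum, map_sum, Matrix.sum_apply, Matrix.of_apply]
  simp only [extendRep_tmul]
  rw [← Finset.sum_subset (Finset.subset_univ x.support)]
  · refine Finset.sum_congr rfl fun g _ => ?_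
    rw [MonoidAlgebra.lift_of]
    rfl
  · intro g _ hg
    rw [Finsupp.notMem_support_iff.1 hg, zero_mul]

variable [Fintype G] (ρ : G →* GL (Fin 2) A)

theorem Determinant.nm_ofRep (g : G) :
    (Determinant.ofRep ρ).nm g = (ρ g : Matrix (Fin 2) (Fin 2) A).det := by
  classical
  rw [nm, eval_ofRep]
  congr 1
  ext i j
  simp [Finsupp.single_apply]

theorem Determinant.tr_ofRep (g : G) :
    (Determinant.ofRep ρ).tr g = (ρ g : Matrix (Fin 2) (Fin 2) A).trace := by
  classical
  rw [tr, nm_ofRep, nm_ofRep, eval_ofRep]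
  simp only [Finsupp.add_apply, add_mul, Finset.sum_add_distrib]
  simp only [Finsupp.single_apply, ite_mul, zero_mul, one_mul, Finset.sum_ite_eq, Finset.mem_univ,
    if_true, RingHom.id_apply, Matrix.det_fin_two, Matrix.of_apply, Matrix.trace_fin_two]
  simp
  ring

end ofRep

section ofQuad

variable {A : Type} [CommRing A] {G : Type} [Group G] [Fintype G]

/-- The polynomial law of a quadratic form on the group ring. -/
def quadLaw (M : G → G → A) : MonoidAlgebra A G →ₚₗ[A] A where
  toFun' := fun S _ _ z => quadEval M (algebraMap A S) (ofTensor A S G z).coeff ⊗ₜ[A] 1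
  isCompat' := by
    intro S _ _ S' _ _ φ
    funext z
    rw [Function.comp_apply, Function.comp_apply, LinearMap.rTensor_tmul, AlgHom.toLinearMap_apply]
    congr 1
    have h := map_quadEval M (algebraMap A S) (φ : S →+* S') (ofTensor A S G z).coeff
    rw [φ.comp_algebraMap] at h
    refine h.trans ?_
    congr 1
    funext g
    rw [ofTensor_rTensor]
    rfl

/-- The determinant of a multiplicative quadratic form on the group ring. -/
def Determinant.ofQuad (M : G → G → A) (h1 : M 1 1 = 1)
    (hmul : ∀ (S : Type) [CommRing S] (φ : A →+* S) (x y : MonoidAlgebra S G),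
      quadEval M φ (x * y).coeff = quadEval M φ x.coeff * quadEval M φ y.coeff) :
    Determinant A G 2 where
  law := quadLaw M
  map_one := by
    classical
    intro S _ _
    change quadEval M (algebraMap A S) (ofTensor A S G 1).coeff ⊗ₜ[A] 1 = 1
    rw [_root_.map_one, MonoidAlgebra.one_def, MonoidAlgebra.coeff_single,
      Finsupp.single_eq_pi_single, quadEval_single, h1, _root_.map_one,
      Algebra.TensorProduct.one_def]
  map_mul := by
    intro S _ _ x y
    change quadEval M (algebraMap A S) (ofTensor A S G (x * y)).coeff ⊗ₜ[A] 1 =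
      quadEval M (algebraMap A S) (ofTensor A S G x).coeff ⊗ₜ[A] 1 *
        quadEval M (algebraMap A S) (ofTensor A S G y).coeff ⊗ₜ[A] 1
    rw [_root_.map_mul, hmul, Algebra.TensorProduct.tmul_mul_tmul, mul_one]
  map_smul := by
    intro S _ _ b x
    change quadEval M (algebraMap A S) (ofTensor A S G (b • x)).coeff ⊗ₜ[A] 1 =
      b ^ 2 • quadEval M (algebraMap A S) (ofTensor A S G x).coeff ⊗ₜ[A] 1
    rw [_root_.map_smul, MonoidAlgebra.coeff_smul, Finsupp.coe_smul, quadEval_smul,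
      TensorProduct.smul_tmul', smul_eq_mul]

theorem Determinant.eval_ofQuad (M : G → G → A) (h1 : M 1 1 = 1)
    (hmul : ∀ (S : Type) [CommRing S] (φ : A →+* S) (x y : MonoidAlgebra S G),
      quadEval M φ (x * y).coeff = quadEval M φ x.coeff * quadEval M φ y.coeff)
    {S : Type} [CommRing S] (φ : A →+* S) (x : G →₀ S) :
    (Determinant.ofQuad M h1 hmul).eval φ x = quadEval M φ x := by
  let _ := φ.toAlgebra
  have := (Determinant.ofQuad M h1 hmul).eval_eq_toTensor φ (MonoidAlgebra.ofCoeff x)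
  rw [MonoidAlgebra.coeff_ofCoeff] at this
  rw [this]
  change TensorProduct.rid A S (quadEval M (algebraMap A S) (ofTensor A S G _).coeff ⊗ₜ[A] 1) = _
  rw [TensorProduct.rid_tmul, one_smul, ofTensor_toTensor]
  rfl

/-- Two-dimensional determinants can be base changed. -/
theorem Determinant.exists_isBaseChange {A' : Type} [CommRing A'] (φ : A →+* A')
    (D : Determinant A G 2) : ∃ D' : Determinant A' G 2, D.IsBaseChange φ D' := by
  obtain ⟨M, hM⟩ := D.exists_quadEval
  refine ⟨ofQuad (fun i j => φ (M i j)) (by rw [D.quadEval_diag hM, nm_one, _root_.map_one]) ?_,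
    fun B _ f x => ?_⟩
  · intro S _ f x y
    simp only [quadEval_comp, ← hM, eval_mul]
  · rw [eval_ofQuad, quadEval_comp, hM]

/-- A determinant over `B` whose traces and norms come from a subring `A` is defined over `A`. -/
theorem Determinant.exists_isBaseChange_of_injective {B : Type} [CommRing B] (ι : A →+* B)
    (hι : Function.Injective ι) (D : Determinant B G 2) (ht : ∀ g, ∃ a, ι a = D.tr g)
    (hn : ∀ g, ∃ a, ι a = D.nm g) : ∃ D' : Determinant A G 2, D'.IsBaseChange ι D := by
  classical
  choose t ht using ht
  choose n hn using hn
  obtain ⟨M, hM⟩ := D.exists_quadEval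
  -- The entries of `M` need not come from `A`; only the diagonal and the sums `M g h + M h g` are
  -- known to. An arbitrary order on `G` makes it possible to put each such sum into a single entry
  -- of a triangular matrix `N` over `A`.
  let _ : LinearOrder G := LinearOrder.lift' (Fintype.equivFin G) (Fintype.equivFin G).injective
  let N : G → G → A := fun g h =>
    if g = h then n g else if g < h then t (g * h⁻¹) * n h else 0
  have hN : ∀ (S : Type) [CommRing S] (f : B →+* S) (x : G → S),
      quadEval N (f.comp ι) x = quadEval M f x := by
    intro S _ f x
    have hlt : ∀ g h, g < h → ι (N g h + N h g) = M g h + M h g := by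
      intro g h hlt
      simp only [N, if_neg hlt.ne, if_neg hlt.ne', if_pos hlt, if_neg hlt.asymm, add_zero]
      rw [D.quadEval_polar hM, _root_.map_mul, ht, hn]
    have hd : ∀ g, ι (N g g) = M g g := fun g => by
      simp only [N, if_true, hn, D.quadEval_diag hM]
    refine quadEval_congr _ _ _ _ (fun g => ?_) (fun g h => ?_) x
    · rw [RingHom.comp_apply, hd]
    · rw [RingHom.comp_apply]
      rcases lt_trichotomy g h with h1 | rfl | h1
      · rw [hlt g h h1]
      · rw [map_add ι, hd]
      · rw [add_comm, hlt h g h1, add_comm]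
  refine ⟨ofQuad N (hι ?_) ?_, fun S _ f x => ?_⟩
  · simp only [N, if_true, hn, nm_one, _root_.map_one]
  · -- the multiplicativity is checked for generic elements, over a polynomial ring
    have generic : ∀ (x y : MonoidAlgebra (MvPolynomial (G ⊕ G) A) G),
        quadEval N MvPolynomial.C (x * y).coeff =
          quadEval N MvPolynomial.C x.coeff * quadEval N MvPolynomial.C y.coeff := by
      intro x y
      let θ := MvPolynomial.map (σ := G ⊕ G) ι
      have hθ : ∀ x : MonoidAlgebra (MvPolynomial (G ⊕ G) A) G,
          θ (quadEval N MvPolynomial.C x.coeff) =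
            D.eval MvPolynomial.C (MonoidAlgebra.mapRingHom G θ x).coeff := by
        intro x
        rw [map_quadEval, hM, ← hN]
        have : θ.comp MvPolynomial.C = MvPolynomial.C.comp ι := by ext; simp [θ]
        rw [this]
        congr 1
      -- Injectivity of `ι` survives the passage to polynomial rings but not an arbitrary base
      -- change, which is why the generic case comes first and is then specialized.
      apply MvPolynomial.map_injective ι hι
      change θ _ = θ _
      rw [_root_.map_mul, hθ, hθ, hθ, _root_.map_mul, eval_mul]
    intro S _ f x y
    let X : MonoidAlgebra (MvPolynomial (G ⊕ G) A) G :=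
      MonoidAlgebra.ofCoeff (Finsupp.equivFunOnFinite.symm fun g => MvPolynomial.X (Sum.inl g))
    let Y : MonoidAlgebra (MvPolynomial (G ⊕ G) A) G :=
      MonoidAlgebra.ofCoeff (Finsupp.equivFunOnFinite.symm fun g => MvPolynomial.X (Sum.inr g))
    let θ := MvPolynomial.eval₂Hom f (Sum.elim x.coeff y.coeff)
    have hθ : ∀ x : MonoidAlgebra (MvPolynomial (G ⊕ G) A) G,
        θ (quadEval N MvPolynomial.C x.coeff) =
          quadEval N f (MonoidAlgebra.mapRingHom G θ x).coeff := by
      intro x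
      rw [map_quadEval]
      have : θ.comp MvPolynomial.C = f := by ext; simp [θ]
      rw [this]
      congr 1
    have hX : MonoidAlgebra.mapRingHom G θ X = x := by ext g; simp [X, θ]
    have hY : MonoidAlgebra.mapRingHom G θ Y = y := by ext g; simp [Y, θ]
    have h := congrArg θ (generic X Y)
    rwa [_root_.map_mul, hθ, hθ, hθ, _root_.map_mul, hX, hY] at h
  · rw [eval_ofQuad, hN, hM]

end ofQuad

/-! ### Relations between the traces and norms of a dihedral determinant, and the ring they present
-/

section

/-- The linear recurrence `u (k + 2) = z * u (k + 1) - δ * u k` satisfied by the traces of the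
matrices `h * c ^ k`, where `c` has trace `z` and determinant `δ`. -/
def lucas {A : Type} [CommRing A] (δ z u₀ u₁ : A) : ℕ → A
  | 0 => u₀
  | 1 => u₁
  | k + 2 => z * lucas δ z u₀ u₁ (k + 1) - δ * lucas δ z u₀ u₁ k

theorem map_lucas {A B : Type} [CommRing A] [CommRing B] (φ : A →+* B) (δ z u₀ u₁ : A) (k : ℕ) :
    φ (lucas δ z u₀ u₁ k) = lucas (φ δ) (φ z) (φ u₀) (φ u₁) k := by
  induction k using Nat.twoStepInduction with
  | zero => rfl
  | one => rfl
  | more k h1 h2 => simp only [lucas, map_sub, map_mul, h1, h2]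

/-- The equations between the traces `x`, `y`, `z` of `a`, `b`, `ab` and the norms `α`, `β` of
`a`, `b` under a two-dimensional determinant of `⟨a, b | a², b², (ab)^(2M)⟩`. -/
structure IsPseudoPoint {A : Type} [CommRing A] (M : ℕ) (x y z α β : A) : Prop where
  xx : x * x = 2 * (1 + α)
  yy : y * y = 2 * (1 + β)
  aa : α * α = 1
  bb : β * β = 1
  ax : α * x = x
  bY : β * y = y
  xz : x * z = (1 + α) * y
  yz : y * z = (1 + β) * x
  xy : x * y = (1 + α) * z
  xy' : x * y = (1 + β) * z
  lucas_eq : lucas (α * β) z 2 z (M + 1) = lucas (α * β) z 2 z (M - 1)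

namespace Determinant

variable {A : Type} [CommRing A] {m : ℕ} (D : Determinant A (DihedralGroup m) 2)

open DihedralGroup

theorem nm_r_one : D.nm (r 1) = D.nm (sr 0) * D.nm (sr 1) := by
  rw [← nm_mul, sr_mul_sr, sub_zero]

theorem tr_r_neg (i : ZMod m) : D.tr (r (-i)) = D.tr (r i) := by
  have h := D.tr_mul_comm (sr i) (sr 0)
  rwa [sr_mul_sr, sr_mul_sr, zero_sub, sub_zero] at h

theorem nm_r (k : ℕ) : D.nm (r (k : ZMod m)) = (D.nm (sr 0) * D.nm (sr 1)) ^ k := by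
  induction k with
  | zero => rw [Nat.cast_zero, ← one_def, nm_one, pow_zero]
  | succ k ih => rw [Nat.cast_succ, ← r_mul_r, nm_mul, ih, nm_r_one, pow_succ]

theorem nm_sr (k : ℕ) :
    D.nm (sr (k : ZMod m)) = D.nm (sr 0) * (D.nm (sr 0) * D.nm (sr 1)) ^ k := by
  rw [← nm_r, ← nm_mul, sr_mul_r, zero_add]

variable [NeZero m]

/-- The recurrence is `tr_mul_tr` with second factor `r 1`, whose norm is `nm (sr 0) * nm (sr 1)`.
-/
theorem tr_r (k : ℕ) : D.tr (r (k : ZMod m)) =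
    lucas (D.nm (sr 0) * D.nm (sr 1)) (D.tr (r 1)) 2 (D.tr (r 1)) k := by
  induction k using Nat.twoStepInduction with
  | zero => rw [Nat.cast_zero, ← one_def, tr_one, lucas]
  | one => rw [Nat.cast_one, lucas]
  | more k h1 h2 =>
    have h := D.tr_mul_tr (r ((k + 1 : ℕ) : ZMod m)) (r 1)
    rw [inv_r, r_mul_r, r_mul_r, nm_r_one, h2, Nat.cast_succ, add_neg_cancel_right, h1] at h
    rw [lucas, show ((k + 2 : ℕ) : ZMod m) = k + 1 + 1 by push_cast; ring]
    linear_combination -h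

theorem tr_sr (k : ℕ) : D.tr (sr (k : ZMod m)) =
    lucas (D.nm (sr 0) * D.nm (sr 1)) (D.tr (r 1)) (D.tr (sr 0)) (D.tr (sr 1)) k := by
  induction k using Nat.twoStepInduction with
  | zero => rw [Nat.cast_zero, lucas]
  | one => rw [Nat.cast_one, lucas]
  | more k h1 h2 =>
    have h := D.tr_mul_tr (sr ((k + 1 : ℕ) : ZMod m)) (r 1)
    rw [inv_r, sr_mul_r, sr_mul_r, nm_r_one, h2, Nat.cast_succ, add_neg_cancel_right, h1] at h
    rw [lucas, show ((k + 2 : ℕ) : ZMod m) = k + 1 + 1 by push_cast; ring]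
    linear_combination -h

/-- A determinant of the dihedral group is determined by its values on `a`, `b`, `ab`. -/
theorem isBaseChange_of_generators {A' : Type} [CommRing A'] (φ : A →+* A')
    (D' : Determinant A' (DihedralGroup m) 2) (hx : φ (D.tr (sr 0)) = D'.tr (sr 0))
    (hy : φ (D.tr (sr 1)) = D'.tr (sr 1)) (hz : φ (D.tr (r 1)) = D'.tr (r 1))
    (hα : φ (D.nm (sr 0)) = D'.nm (sr 0)) (hβ : φ (D.nm (sr 1)) = D'.nm (sr 1)) :
    D.IsBaseChange φ D' := by
  rw [isBaseChange_iff]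
  constructor
  · rintro (i | i)
    · rw [← ZMod.natCast_zmod_val i, tr_r, tr_r, map_lucas]
      simp only [_root_.map_mul φ, hα, hβ, hz, map_ofNat]
    · rw [← ZMod.natCast_zmod_val i, tr_sr, tr_sr, map_lucas]
      simp only [_root_.map_mul φ, hα, hβ, hx, hy, hz]
  · rintro (i | i)
    · rw [← ZMod.natCast_zmod_val i, nm_r, nm_r]
      simp only [_root_.map_mul φ, map_pow φ, hα, hβ]
    · rw [← ZMod.natCast_zmod_val i, nm_sr, nm_sr]
      simp only [_root_.map_mul φ, map_pow φ, hα, hβ]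

/-- Apart from the multiplicativity of the norm on `a * a` and `b * b`, the equations are instances
of `tr_mul_tr` for `1`, the two reflections and `r 1`, `r (-1)`, together with `tr (r (-i)) = tr (r
i)`. The order of the rotation enters only in the last equation. -/
theorem isPseudoPoint {M : ℕ} (hM : 1 ≤ M) (hm : m = 2 * M) :
    IsPseudoPoint M (D.tr (sr 0)) (D.tr (sr 1)) (D.tr (r 1)) (D.nm (sr 0)) (D.nm (sr 1)) := by
  have hneg : D.tr (r (-1)) = D.tr (r 1) := D.tr_r_neg 1
  have inv : ∀ i : ZMod m, (sr i)⁻¹ = sr i := fun i => rfl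
  have haa := D.nm_mul (sr 0) (sr 0)
  have hbb := D.nm_mul (sr 1) (sr 1)
  have h1 := D.tr_mul_tr (sr 0) (sr 0)
  have h2 := D.tr_mul_tr (sr 1) (sr 1)
  have h3 := D.tr_mul_tr 1 (sr 0)
  have h4 := D.tr_mul_tr 1 (sr 1)
  have h5 := D.tr_mul_tr (r (-1)) (sr 0)
  have h6 := D.tr_mul_tr (r 1) (sr 1)
  have h7 := D.tr_mul_tr (sr 1) (sr 0)
  have h8 := D.tr_mul_tr (sr 0) (sr 1)
  have h9 := D.tr_r_neg ((M - 1 : ℕ) : ZMod m)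
  -- Inversion sends the rotation by `M - 1` to the one by `M + 1`, since their sum is `2M = m`.
  -- Equality of these two traces is the relation `lucas_eq`.
  have e : -((M - 1 : ℕ) : ZMod m) = ((M + 1 : ℕ) : ZMod m) := by
    rw [neg_eq_iff_add_eq_zero, ← Nat.cast_add, show M - 1 + (M + 1) = m by omega,
      ZMod.natCast_self]
  rw [e, tr_r, tr_r] at h9
  simp only [inv, one_mul, sr_mul_sr, r_mul_sr, sub_self, ← one_def, nm_one, tr_one, zero_sub,
    sub_zero, hneg, sub_neg_eq_add, zero_add] at *
  refine ⟨?_, ?_, haa.symm, hbb.symm, ?_, ?_, ?_, ?_, ?_, ?_, h9⟩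
  · linear_combination h1
  · linear_combination h2
  · linear_combination -h3
  · linear_combination -h4
  · linear_combination h5
  · linear_combination h6
  · linear_combination h7
  · linear_combination h8

end Determinant

/-- The polynomials whose vanishing is expressed by `IsPseudoPoint`. -/
def pseudoRelations (R : Type) [CommRing R] (M : ℕ) : Set (MvPolynomial (Fin 5) R) :=
  let x := MvPolynomial.X 0
  let y := MvPolynomial.X 1
  let z := MvPolynomial.X 2
  let α := MvPolynomial.X 3
  let β := MvPolynomial.X 4
  {x * x - 2 * (1 + α), y * y - 2 * (1 + β), α * α - 1, β * β - 1, α * x - x, β * y - y,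
    x * z - (1 + α) * y, y * z - (1 + β) * x, x * y - (1 + α) * z, x * y - (1 + β) * z,
    lucas (α * β) z 2 z (M + 1) - lucas (α * β) z 2 z (M - 1)}

theorem isPseudoPoint_iff {R A : Type} [CommRing R] [CommRing A] {M : ℕ}
    (f : MvPolynomial (Fin 5) R →+* A) : (∀ p ∈ pseudoRelations R M, f p = 0) ↔
      IsPseudoPoint M (f (MvPolynomial.X 0)) (f (MvPolynomial.X 1)) (f (MvPolynomial.X 2))
        (f (MvPolynomial.X 3)) (f (MvPolynomial.X 4)) := by
  simp only [pseudoRelations, Set.mem_insert_iff, Set.mem_singleton_iff, forall_eq_or_imp,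
    forall_eq, map_sub, map_mul, map_add, map_one, map_ofNat, map_lucas, sub_eq_zero]
  exact ⟨fun ⟨h1, h2, h3, h4, h5, h6, h7, h8, h9, h10, h11⟩ =>
    ⟨h1, h2, h3, h4, h5, h6, h7, h8, h9, h10, h11⟩,
    fun ⟨h1, h2, h3, h4, h5, h6, h7, h8, h9, h10, h11⟩ =>
    ⟨h1, h2, h3, h4, h5, h6, h7, h8, h9, h10, h11⟩⟩

/-- The universal ring for the equations of `IsPseudoPoint`. -/
abbrev PseudoRing (R : Type) [CommRing R] (M : ℕ) : Type :=
  MvPolynomial (Fin 5) R ⧸ Ideal.span (pseudoRelations R M)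

/-- The coordinates of the universal point. -/
def PseudoRing.coord (R : Type) [CommRing R] (M : ℕ) (i : Fin 5) : PseudoRing R M :=
  Ideal.Quotient.mk _ (MvPolynomial.X i)

section PseudoRing

variable (R : Type) [CommRing R] (M : ℕ)

open PseudoRing

theorem PseudoRing.isPseudoPoint : IsPseudoPoint M (coord R M 0) (coord R M 1) (coord R M 2)
    (coord R M 3) (coord R M 4) := by
  exact (isPseudoPoint_iff (Ideal.Quotient.mk (Ideal.span (pseudoRelations R M)))).1
    fun p hp => Ideal.Quotient.eq_zero_iff_mem.2 (Ideal.subset_span hp)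

variable {R M}

/-- The homomorphism to an algebra given by a point. -/
def PseudoRing.lift {A : Type} [CommRing A] [Algebra R A] {x y z α β : A}
    (h : IsPseudoPoint M x y z α β) : PseudoRing R M →ₐ[R] A :=
  Ideal.Quotient.liftₐ _ (MvPolynomial.aeval ![x, y, z, α, β]) (by
    intro p hp
    have h' := (isPseudoPoint_iff (M := M)
      (MvPolynomial.aeval (R := R) ![x, y, z, α, β]).toRingHom).2 (by simpa using h)
    exact (Ideal.span_le (I := RingHom.ker
      (MvPolynomial.aeval (R := R) ![x, y, z, α, β]).toRingHom)).2 h' hp)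

theorem PseudoRing.lift_coord {A : Type} [CommRing A] [Algebra R A] {x y z α β : A}
    (h : IsPseudoPoint M x y z α β) (i : Fin 5) :
    PseudoRing.lift (R := R) h (coord R M i) = ![x, y, z, α, β] i := by
  exact MvPolynomial.aeval_X _ i

theorem PseudoRing.algHom_ext {A : Type} [CommRing A] [Algebra R A] {f g : PseudoRing R M →ₐ[R] A}
    (h : ∀ i, f (coord R M i) = g (coord R M i)) : f = g := by
  refine Ideal.Quotient.algHom_ext _ (MvPolynomial.algHom_ext fun i => h i)

end PseudoRing

end

/-! ### A spanning set of `M + 9` monomials -/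

/-- The span of the monomials other than powers of `z`, and of the powers `z ^ i` with `i < k`. -/
def normalSpan (R : Type) {A : Type} [CommRing R] [CommRing A] [Algebra R A]
    (x y z α β : A) (k : ℕ) : Submodule R A :=
  Submodule.span R ({x, y, α, β, α * β, x * y, x * z, y * z} ∪ {p | ∃ i < k, p = z ^ i})

namespace IsPseudoPoint

variable {R A : Type} [CommRing R] [CommRing A] [Algebra R A] {x y z α β : A} {M : ℕ}

/-- The equations are symmetric under the exchange of the two reflections, so multiplication by `y`
and `β` follows from multiplication by `x` and `α`. -/
theorem symm (h : IsPseudoPoint M x y z α β) : IsPseudoPoint M y x z β α where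
  xx := h.yy
  yy := h.xx
  aa := h.bb
  bb := h.aa
  ax := h.bY
  bY := h.ax
  xz := h.yz
  yz := h.xz
  xy := by rw [mul_comm, h.xy']
  xy' := by rw [mul_comm, h.xy]
  lucas_eq := by rw [mul_comm β α]; exact h.lucas_eq

theorem normalSpan_symm (R : Type) [CommRing R] [Algebra R A] (x y z α β : A) (k : ℕ) :
    normalSpan R y x z β α k = normalSpan R x y z α β k := by
  rw [normalSpan, normalSpan]
  congr 2
  ext p
  simp only [Set.mem_insert_iff, Set.mem_singleton_iff, mul_comm β α, mul_comm y x]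
  tauto

theorem normalSpan_mono {k l : ℕ} (hkl : k ≤ l) :
    normalSpan R x y z α β k ≤ normalSpan R x y z α β l := by
  refine Submodule.span_mono (Set.union_subset_union_right _ ?_)
  rintro p ⟨i, hi, rfl⟩
  exact ⟨i, hi.trans_le hkl, rfl⟩

theorem pow_mem {k i : ℕ} (hi : i < k) : z ^ i ∈ normalSpan R x y z α β k :=
  Submodule.subset_span (Or.inr ⟨i, hi, rfl⟩)

theorem mem_normalSpan (k : ℕ) : x ∈ normalSpan R x y z α β k ∧ y ∈ normalSpan R x y z α β k ∧
    α ∈ normalSpan R x y z α β k ∧ β ∈ normalSpan R x y z α β k ∧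
    α * β ∈ normalSpan R x y z α β k ∧ x * y ∈ normalSpan R x y z α β k ∧
    x * z ∈ normalSpan R x y z α β k ∧ y * z ∈ normalSpan R x y z α β k := by
  refine ⟨?_, ?_, ?_, ?_, ?_, ?_, ?_, ?_⟩ <;>
    exact Submodule.subset_span (Or.inl (by simp))

theorem two_mul_mem {N : Submodule R A} {a : A} (ha : a ∈ N) : 2 * a ∈ N := by
  rw [two_mul]
  exact N.add_mem ha ha

variable (h : IsPseudoPoint M x y z α β)

include h

/-- The relations give `x z² = 2 y z` and `y z² = 2 x z`, hence `x z³ = 4 x z`. The induction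
carries three consecutive exponents because the reduction lowers the exponent by two, from three on.
-/
theorem x_mul_pow_mem {k : ℕ} (i : ℕ) : x * z ^ i ∈ normalSpan R x y z α β k := by
  obtain ⟨mx, my, ma, mb, mab, mxy, mxz, myz⟩ := mem_normalSpan (R := R) (x := x) (y := y) (z := z)
    (α := α) (β := β) k
  suffices H : x * z ^ i ∈ normalSpan R x y z α β k ∧ x * z ^ (i + 1) ∈ normalSpan R x y z α β k ∧
      x * z ^ (i + 2) ∈ normalSpan R x y z α β k from H.1
  induction i with
  | zero =>
    refine ⟨by simpa using mx, by simpa using mxz, ?_⟩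
    have : x * z ^ (0 + 2) = 2 * (y * z) := by
      linear_combination z * h.xz + (1 + α) * h.yz + (1 + β) * h.ax - 2 * h.yz
    rw [this]
    exact two_mul_mem myz
  | succ i ih =>
    refine ⟨ih.2.1, ih.2.2, ?_⟩
    have : x * z ^ (i + 1 + 2) = 2 * (2 * (x * z ^ (i + 1))) := by
      have e1 : x * z ^ 2 = 2 * (y * z) := by
        linear_combination z * h.xz + (1 + α) * h.yz + (1 + β) * h.ax - 2 * h.yz
      have e2 : y * z ^ 2 = 2 * (x * z) := by
        linear_combination z * h.yz + (1 + β) * h.xz + (1 + α) * h.bY - 2 * h.xz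
      linear_combination (z ^ i * z) * e1 + 2 * z ^ i * e2
    rw [this]
    exact two_mul_mem (two_mul_mem ih.2.1)

/-- Here `x y z = 2 (1 + α) (1 + β)` and `x y z² = 4 x y`, so the powers of `z` never grow. -/
theorem xy_mul_pow_mem {k : ℕ} (hk : 1 ≤ k) (i : ℕ) :
    x * y * z ^ i ∈ normalSpan R x y z α β k := by
  obtain ⟨mx, my, ma, mb, mab, mxy, mxz, myz⟩ := mem_normalSpan (R := R) (x := x) (y := y) (z := z)
    (α := α) (β := β) k
  have m1 : (1 : A) ∈ normalSpan R x y z α β k := by simpa using pow_mem (z := z) (i := 0) hk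
  have e0 : x * y * z = 2 * (1 + α + β + α * β) := by
    linear_combination y * h.xz + (1 + α) * h.yy
  have e1 : x * y * z ^ 2 = 2 * (2 * (x * y)) := by
    linear_combination z * e0 - 2 * (1 + α) * h.xy' + 2 * y * h.ax
  suffices H : x * y * z ^ i ∈ normalSpan R x y z α β k ∧
      x * y * z ^ (i + 1) ∈ normalSpan R x y z α β k from H.1
  induction i with
  | zero =>
    refine ⟨by simpa using mxy, ?_⟩
    rw [zero_add, pow_one, e0]
    exact two_mul_mem (add_mem (add_mem (add_mem m1 ma) mb) mab)
  | succ i ih =>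
    refine ⟨ih.2, ?_⟩
    have : x * y * z ^ (i + 1 + 1) = 2 * (2 * (x * y * z ^ i)) := by
      linear_combination z ^ i * e1
    rw [this]
    exact two_mul_mem (two_mul_mem ih.1)

theorem x_mul_mem {k : ℕ} (hk : 1 ≤ k) {p : A} (hp : p ∈ normalSpan R x y z α β k) :
    x * p ∈ normalSpan R x y z α β k := by
  obtain ⟨mx, my, ma, mb, mab, mxy, mxz, myz⟩ := mem_normalSpan (R := R) (x := x) (y := y) (z := z)
    (α := α) (β := β) k
  have m1 : (1 : A) ∈ normalSpan R x y z α β k := by simpa using pow_mem (z := z) (i := 0) hk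
  suffices H : normalSpan R x y z α β k ≤
      (normalSpan R x y z α β k).comap (LinearMap.mulLeft R x) from H hp
  refine Submodule.span_le.2 ?_
  rintro q (hq | ⟨i, hi, rfl⟩)
  · simp only [Set.mem_insert_iff, Set.mem_singleton_iff] at hq
    rw [SetLike.mem_coe, Submodule.mem_comap, LinearMap.mulLeft_apply]
    rcases hq with rfl | rfl | rfl | rfl | rfl | rfl | rfl | rfl
    · rw [h.xx]
      exact two_mul_mem (add_mem m1 ma)
    · exact mxy
    · rw [mul_comm, h.ax]
      exact mx
    · rw [show x * q = y * z - x by linear_combination -h.yz]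
      exact sub_mem myz mx
    · rw [show x * (α * β) = y * z - x by linear_combination β * h.ax - h.yz]
      exact sub_mem myz mx
    · rw [show x * (x * y) = 2 * (x * z) by linear_combination y * h.xx - 2 * h.xz]
      exact two_mul_mem mxz
    · rw [show x * (x * z) = 2 * (x * y) by linear_combination z * h.xx - 2 * h.xy]
      exact two_mul_mem mxy
    · rw [← mul_assoc]
      simpa using h.xy_mul_pow_mem hk 1
  · exact h.x_mul_pow_mem i

theorem α_mul_mem {k : ℕ} (hk : 1 ≤ k) {p : A} (hp : p ∈ normalSpan R x y z α β k) :
    α * p ∈ normalSpan R x y z α β k := by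
  obtain ⟨mx, my, ma, mb, mab, mxy, mxz, myz⟩ := mem_normalSpan (R := R) (x := x) (y := y) (z := z)
    (α := α) (β := β) k
  have m1 : (1 : A) ∈ normalSpan R x y z α β k := by simpa using pow_mem (z := z) (i := 0) hk
  suffices H : normalSpan R x y z α β k ≤
      (normalSpan R x y z α β k).comap (LinearMap.mulLeft R α) from H hp
  refine Submodule.span_le.2 ?_
  rintro q (hq | ⟨i, hi, rfl⟩)
  · simp only [Set.mem_insert_iff, Set.mem_singleton_iff] at hq
    rw [SetLike.mem_coe, Submodule.mem_comap, LinearMap.mulLeft_apply]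
    rcases hq with rfl | rfl | rfl | rfl | rfl | rfl | rfl | rfl
    · rw [h.ax]
      exact mx
    · rw [show α * q = x * z - q by linear_combination -h.xz]
      exact sub_mem mxz my
    · rw [h.aa]
      exact m1
    · exact mab
    · rw [← mul_assoc, h.aa, one_mul]
      exact mb
    · rw [← mul_assoc, h.ax]
      exact mxy
    · rw [← mul_assoc, h.ax]
      exact mxz
    · rw [show α * (y * z) = y * z by
        linear_combination α * h.yz + (1 + β) * h.ax - h.yz]
      exact myz
  · rw [SetLike.mem_coe, Submodule.mem_comap, LinearMap.mulLeft_apply]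
    cases i with
    | zero => simpa using ma
    | succ i =>
      -- The monomials `α z ^ (i + 1)` are not in the spanning set; the relation `x y = (1 + α) z`
      -- exchanges them for multiples of `x y`.
      rw [show α * z ^ (i + 1) = x * y * z ^ i - z ^ (i + 1) by
        linear_combination -z ^ i * h.xy]
      exact sub_mem (h.xy_mul_pow_mem hk i) (pow_mem hi)

theorem y_mul_mem {k : ℕ} (hk : 1 ≤ k) {p : A} (hp : p ∈ normalSpan R x y z α β k) :
    y * p ∈ normalSpan R x y z α β k := by
  rw [← normalSpan_symm] at hp ⊢
  exact h.symm.x_mul_mem hk hp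

theorem β_mul_mem {k : ℕ} (hk : 1 ≤ k) {p : A} (hp : p ∈ normalSpan R x y z α β k) :
    β * p ∈ normalSpan R x y z α β k := by
  rw [← normalSpan_symm] at hp ⊢
  exact h.symm.α_mul_mem hk hp

theorem z_mul_mem_succ {k : ℕ} (hk : 1 ≤ k) {p : A} (hp : p ∈ normalSpan R x y z α β k) :
    z * p ∈ normalSpan R x y z α β (k + 1) := by
  obtain ⟨mx, my, ma, mb, mab, mxy, mxz, myz⟩ := mem_normalSpan (R := R) (x := x) (y := y) (z := z)
    (α := α) (β := β) (k + 1)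
  have m1 : z ∈ normalSpan R x y z α β (k + 1) := by
    simpa using pow_mem (z := z) (i := 1) (by omega : 1 < k + 1)
  have hk' : 1 ≤ k + 1 := by omega
  suffices H : normalSpan R x y z α β k ≤
      (normalSpan R x y z α β (k + 1)).comap (LinearMap.mulLeft R z) from H hp
  refine Submodule.span_le.2 ?_
  rintro q (hq | ⟨i, hi, rfl⟩)
  · simp only [Set.mem_insert_iff, Set.mem_singleton_iff] at hq
    rw [SetLike.mem_coe, Submodule.mem_comap, LinearMap.mulLeft_apply, mul_comm]
    rcases hq with rfl | rfl | rfl | rfl | rfl | rfl | rfl | rfl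
    · exact mxz
    · exact myz
    · exact h.α_mul_mem hk' m1
    · exact h.β_mul_mem hk' m1
    · rw [mul_assoc]
      exact h.α_mul_mem hk' (h.β_mul_mem hk' m1)
    · simpa using h.xy_mul_pow_mem hk' 1
    · simpa [mul_assoc, pow_two] using h.x_mul_pow_mem (R := R) (k := k + 1) 2
    · rw [← normalSpan_symm]
      simpa [mul_assoc, pow_two] using h.symm.x_mul_pow_mem (R := R) (k := k + 1) 2
  · rw [SetLike.mem_coe, Submodule.mem_comap, LinearMap.mulLeft_apply, ← pow_succ']
    exact pow_mem (by omega)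

/-- The sequence behaves like a monic polynomial of degree `k + 1` in `z`: its leading term is `z ^
(k + 1)`, up to the span with smaller powers of `z`. The second half serves the two-step recurrence.
-/
theorem lucas_mem (k : ℕ) :
    lucas (α * β) z 2 z (k + 1) - z ^ (k + 1) ∈ normalSpan R x y z α β (k + 1) ∧
      lucas (α * β) z 2 z k ∈ normalSpan R x y z α β (k + 1) := by
  induction k with
  | zero =>
    refine ⟨by simp [lucas], ?_⟩
    rw [lucas, ← mul_one 2]
    exact two_mul_mem (by simpa using pow_mem (z := z) (i := 0) (by omega : 0 < 1))
  | succ k ih =>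
    constructor
    · rw [lucas, show z * lucas (α * β) z 2 z (k + 1) - α * β * lucas (α * β) z 2 z k -
        z ^ (k + 1 + 1) = z * (lucas (α * β) z 2 z (k + 1) - z ^ (k + 1)) -
        α * (β * lucas (α * β) z 2 z k) by ring]
      exact sub_mem (h.z_mul_mem_succ (by omega) ih.1)
        (normalSpan_mono (by omega) (h.α_mul_mem (by omega) (h.β_mul_mem (by omega) ih.2)))
    · rw [← sub_add_cancel (lucas (α * β) z 2 z (k + 1)) (z ^ (k + 1))]
      exact add_mem (normalSpan_mono (by omega) ih.1) (pow_mem (by omega))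

theorem z_mul_mem (hM : 1 ≤ M) {p : A} (hp : p ∈ normalSpan R x y z α β (M + 1)) :
    z * p ∈ normalSpan R x y z α β (M + 1) := by
  -- In `lucas_eq` the left side has leading term `z ^ (M + 1)` and the right side involves only
  -- smaller powers, so `z ^ (M + 1)` is reducible.
  have hz : z ^ (M + 1) ∈ normalSpan R x y z α β (M + 1) := by
    have h1 := (h.lucas_mem (R := R) M).1
    have h2 := (h.lucas_mem (R := R) (M - 1)).2
    rw [h.lucas_eq] at h1
    rw [Nat.sub_add_cancel hM] at h2
    have := sub_mem (normalSpan_mono (by omega : M ≤ M + 1) h2) h1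
    rwa [sub_sub_cancel] at this
  have hle : normalSpan R x y z α β (M + 1 + 1) ≤ normalSpan R x y z α β (M + 1) := by
    refine Submodule.span_le.2 ?_
    rintro q (hq | ⟨i, hi, rfl⟩)
    · exact Submodule.subset_span (Or.inl hq)
    · rcases Nat.lt_succ_iff_lt_or_eq.1 hi with hi | rfl
      · exact pow_mem hi
      · exact hz
  exact hle (h.z_mul_mem_succ (by omega) hp)

end IsPseudoPoint

/-- The spanning monomials of the universal ring. -/
def PseudoRing.monomials (R : Type) [CommRing R] (M : ℕ) : Fin 8 ⊕ Fin (M + 1) → PseudoRing R M :=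
  Sum.elim ![coord R M 0, coord R M 1, coord R M 3, coord R M 4, coord R M 3 * coord R M 4,
    coord R M 0 * coord R M 1, coord R M 0 * coord R M 2, coord R M 1 * coord R M 2]
    (fun i => coord R M 2 ^ (i : ℕ))

theorem PseudoRing.span_monomials (R : Type) [CommRing R] {M : ℕ} (hM : 1 ≤ M) :
    Submodule.span R (Set.range (PseudoRing.monomials R M)) = ⊤ := by
  have h := PseudoRing.isPseudoPoint R M
  have e : Submodule.span R (Set.range (PseudoRing.monomials R M)) = normalSpan R (coord R M 0)
      (coord R M 1) (coord R M 2) (coord R M 3) (coord R M 4) (M + 1) := by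
    rw [monomials, Set.Sum.elim_range, normalSpan]
    congr 2
    · simp only [Matrix.range_cons, Matrix.range_empty, Set.union_empty, Set.singleton_union]
    · ext p
      constructor
      · rintro ⟨i, rfl⟩
        exact ⟨i, i.2, rfl⟩
      · rintro ⟨i, hi, rfl⟩
        exact ⟨⟨i, hi⟩, rfl⟩
  rw [e, eq_top_iff]
  rintro p -
  obtain ⟨p, rfl⟩ := Ideal.Quotient.mk_surjective p
  have hk : 1 ≤ M + 1 := by omega
  induction p using MvPolynomial.induction_on with
  | C a =>
    have h1 : (1 : PseudoRing R M) ∈ normalSpan R (coord R M 0) (coord R M 1) (coord R M 2)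
        (coord R M 3) (coord R M 4) (M + 1) := by
      simpa using IsPseudoPoint.pow_mem (R := R) (x := coord R M 0) (y := coord R M 1)
        (z := coord R M 2) (α := coord R M 3) (β := coord R M 4) (i := 0) hk
    have := Submodule.smul_mem _ a h1
    rw [Algebra.smul_def, mul_one] at this
    exact this
  | add p q hp hq =>
    rw [map_add]
    exact add_mem hp hq
  | mul_X p i hp =>
    rw [map_mul, mul_comm]
    fin_cases i
    · exact h.x_mul_mem hk hp
    · exact h.y_mul_mem hk hp
    · exact h.z_mul_mem hM hp
    · exact h.α_mul_mem hk hp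
    · exact h.β_mul_mem hk hp

/-! ### Representations of the dihedral group by pairs of involutions -/

section

open DihedralGroup in
/-- The presentation of the dihedral group by two involutions. -/
theorem exists_dihedral_hom {H : Type} [Group H] {m : ℕ} {a b : H} (ha : a * a = 1)
    (hb : b * b = 1) (hab : (a * b) ^ m = 1) :
    ∃ f : DihedralGroup m →* H, f (sr 0) = a ∧ f (sr 1) = b := by
  let g : ZMod m →+ Additive H := ZMod.lift m ⟨zmultiplesHom (Additive H) (Additive.ofMul (a * b)), by
    rw [zmultiplesHom_apply, natCast_zsmul, ← ofMul_pow, hab, ofMul_one]⟩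
  let c : ZMod m → H := fun i => (g i).toMul
  have c0 : c 0 = 1 := by simp [c]
  have c_add : ∀ i j, c (i + j) = c i * c j := fun i j => by simp [c]
  have c1 : c 1 = a * b := by
    have : g ((1 : ℤ) : ZMod m) = Additive.ofMul (a * b) := by
      rw [ZMod.lift_coe]; simp
    rw [Int.cast_one] at this
    simp [c, this]
  have ha' : a⁻¹ = a := inv_eq_of_mul_eq_one_left ha
  have hb' : b⁻¹ = b := inv_eq_of_mul_eq_one_left hb
  have conj : ∀ i, a * c (-i) = c i * a := by
    intro i
    obtain ⟨k, rfl⟩ := ZMod.intCast_surjective i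
    have hz : ∀ k : ℤ, c (k : ZMod m) = (a * b) ^ k := fun k => by
      simp only [c, g, ZMod.lift_coe]
      simp
    rw [← Int.cast_neg, hz, hz]
    have : a * b = a * (a * b)⁻¹ * a⁻¹ := by rw [mul_inv_rev, ha', hb', mul_assoc, mul_assoc, ha, mul_one]
    conv_rhs => rw [this, conj_zpow]
    rw [inv_mul_cancel_right, zpow_neg, inv_zpow]
  refine ⟨MonoidHom.mk' (fun x => match x with | r i => c i | sr i => a * c i) ?_, ?_, ?_⟩
  · rintro (i | i) (j | j)
    · exact c_add i j
    · change a * c (j - i) = c i * (a * c j)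
      rw [← mul_assoc, ← conj, mul_assoc, ← c_add, neg_add_eq_sub]
    · change a * c (i + j) = a * c i * c j
      rw [c_add, mul_assoc]
    · change c (j - i) = a * c i * (a * c j)
      have := conj (-i)
      rw [neg_neg] at this
      rw [this, mul_assoc, ← mul_assoc a a, ha, one_mul, ← c_add, neg_add_eq_sub]
  · change a * c 0 = a
    rw [c0, mul_one]
  · change a * c 1 = b
    rw [c1, ← mul_assoc, ha, one_mul]

open DihedralGroup in
theorem dihedral_hom_ext {H : Type} [Group H] {m : ℕ} {f g : DihedralGroup m →* H}
    (h0 : f (sr 0) = g (sr 0)) (h1 : f (sr 1) = g (sr 1)) : f = g := by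
  have hr : ∀ i : ZMod m, f (r i) = g (r i) := by
    intro i
    obtain ⟨k, rfl⟩ := ZMod.intCast_surjective i
    have e : (r (k : ZMod m)) = (sr 0 * sr 1) ^ k := by
      rw [sr_mul_sr, sub_zero, r_one_zpow]
    rw [e, map_zpow, map_zpow, map_mul, map_mul, h0, h1]
  ext x
  rcases x with i | i
  · exact hr i
  · have e : sr i = sr 0 * r i := by rw [sr_mul_r, zero_add]
    rw [e, map_mul, map_mul, h0, hr]

theorem exists_dihedral_rep {A : Type} [CommRing A] {m : ℕ} {a b : Matrix (Fin 2) (Fin 2) A}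
    (ha : a * a = 1) (hb : b * b = 1) (hab : (a * b) ^ m = 1) :
    ∃ ρ : DihedralGroup m →* GL (Fin 2) A, (ρ (.sr 0) : Matrix (Fin 2) (Fin 2) A) = a ∧
      (ρ (.sr 1) : Matrix (Fin 2) (Fin 2) A) = b := by
  obtain ⟨f, h0, h1⟩ := exists_dihedral_hom (H := GL (Fin 2) A) (m := m) (a := ⟨a, a, ha, ha⟩)
    (b := ⟨b, b, hb, hb⟩) (Units.ext ha) (Units.ext hb)
    (Units.ext (by rw [Units.val_pow_eq_pow_val]; exact hab))
  exact ⟨f, by rw [h0], by rw [h1]⟩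

section chebyshev

open Polynomial Chebyshev

theorem monic_chebyshev_S (R : Type) [CommRing R] [Nontrivial R] (n : ℕ) :
    (S R n).Monic ∧ (S R n).natDegree = n := by
  induction n using Nat.twoStepInduction with
  | zero => simp
  | one => simp
  | more n h1 h2 =>
    rw [Nat.cast_succ] at h2
    have h3 : (X * S R (n + 1)).Monic := monic_X.mul h2.1
    have h4 : (X * S R (n + 1)).natDegree = n + 2 := by
      rw [monic_X.natDegree_mul h2.1, natDegree_X, h2.2]
      omega
    have h5 : (S R n).degree < (X * S R (n + 1)).degree := by
      rw [degree_eq_natDegree h1.1.ne_zero, degree_eq_natDegree h3.ne_zero, h1.2, h4]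
      exact_mod_cast Nat.lt_add_of_pos_right (by omega)
    push_cast
    rw [S_add_two]
    refine ⟨h3.sub_of_left h5, ?_⟩
    rw [natDegree_sub_eq_left_of_natDegree_lt (natDegree_lt_natDegree h1.1.ne_zero h5), h4]

/-- Powers of a matrix of determinant one. -/
theorem pow_eq_chebyshev_S {A B : Type} [CommRing A] [Ring B] [Algebra A B] {c : B} {t : A}
    (hc : c * c = t • c - 1) (k : ℕ) :
    c ^ k = (S A (k - 1)).eval t • c - (S A (k - 2)).eval t • (1 : B) := by
  induction k with
  | zero => simp
  | succ k ih =>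
    rw [pow_succ, ih, sub_mul, smul_mul_assoc, hc]
    have e := S_eq A k
    push_cast
    rw [add_sub_cancel_right, show (k + 1 - 2 : ℤ) = k - 1 by ring, e]
    simp only [eval_sub, eval_mul, eval_X, smul_mul_assoc, one_mul, smul_sub, sub_smul, smul_smul]
    rw [mul_comm t]
    abel

/-- The generic two-dimensional representation of the dihedral group whose determinants on the
reflections are `-1`. -/
theorem exists_generic_rep {A : Type} [CommRing A] {M : ℕ} {u : A}
    (hu : u * (S A (M - 1)).eval (u ^ 2 + 2) = 0) :
    ∃ ρ : DihedralGroup (2 * M) →* GL (Fin 2) A,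
      (ρ (.sr 0) : Matrix (Fin 2) (Fin 2) A) = !![1, 0; u, -1] ∧
      (ρ (.sr 1) : Matrix (Fin 2) (Fin 2) A) = !![1, u; 0, -1] := by
  refine exists_dihedral_rep ?_ ?_ ?_
  · rw [Matrix.mul_fin_two, Matrix.one_fin_two]; simp
  · rw [Matrix.mul_fin_two, Matrix.one_fin_two]; simp
  · have hc : (!![1, 0; u, -1] : Matrix (Fin 2) (Fin 2) A) * !![1, u; 0, -1] = !![1, u; u, u ^ 2 + 1] := by
      rw [Matrix.mul_fin_two]; simp [pow_two]
    -- The product `c` of the two involutions has determinant `1` and trace `u ^ 2 + 2`, so `c ^ M =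
    -- s c - s'`. As `s u = 0`, this is the scalar `s - s'`, whose square is `1` by the identity `s²
    -- + s'² - t s s' = 1` at `t = u ^ 2 + 2`, where `t s = 2 s`.
    rw [hc, mul_comm 2 M, pow_mul, pow_eq_chebyshev_S (t := u ^ 2 + 2) (c := !![1, u; u, u ^ 2 + 1]) _ M]
    · set s := (S A (M - 1)).eval (u ^ 2 + 2) with hs
      set s' := (S A (M - 2)).eval (u ^ 2 + 2) with hs'
      have h1 := congrArg (eval (u ^ 2 + 2)) (S_sq_add_S_sq A (M - 2))
      rw [show (M - 2 + 1 : ℤ) = M - 1 by ring] at h1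
      simp only [eval_sub, eval_add, eval_mul, eval_pow, eval_X, eval_one, ← hs, ← hs'] at h1
      have e : s • !![1, u; u, u ^ 2 + 1] - s' • (1 : Matrix (Fin 2) (Fin 2) A) =
          (s - s') • (1 : Matrix (Fin 2) (Fin 2) A) := by
        have hu' : s * u = 0 := by rw [mul_comm]; exact hu
        have hu2 : s * (u ^ 2 + 1) = s := by linear_combination u * hu'
        ext i j
        fin_cases i <;> fin_cases j <;> simp [hu', hu2]
      rw [e, _root_.smul_pow, one_pow, show (s - s') ^ 2 = 1 by linear_combination h1 + u * s' * hu,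
        one_smul]
    · rw [Matrix.mul_fin_two, Matrix.one_fin_two]
      ext i j
      fin_cases i <;> fin_cases j <;> simp <;> ring

end chebyshev

/-- A sum of two characters, with values `e 0, e 2` and `e 1, e 3` on the reflections. All signs are
allowed because the order `2 * M` imposed on the rotation is even. -/
theorem exists_diagonal_rep (A : Type) [CommRing A] (M : ℕ) (e : Fin 4 → ℤˣ) :
    ∃ ρ : DihedralGroup (2 * M) →* GL (Fin 2) A,
      (ρ (.sr 0) : Matrix (Fin 2) (Fin 2) A) = !![((e 0 : ℤ) : A), 0; 0, ((e 1 : ℤ) : A)] ∧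
      (ρ (.sr 1) : Matrix (Fin 2) (Fin 2) A) = !![((e 2 : ℤ) : A), 0; 0, ((e 3 : ℤ) : A)] := by
  have he : ∀ i, ((e i : ℤ) : A) * ((e i : ℤ) : A) = 1 := fun i => by
    rw [← Int.cast_mul, ← Units.val_mul, Int.units_mul_self]; simp
  refine exists_dihedral_rep ?_ ?_ ?_
  · rw [Matrix.mul_fin_two, Matrix.one_fin_two]; simp [he]
  · rw [Matrix.mul_fin_two, Matrix.one_fin_two]; simp [he]
  · rw [pow_mul]
    convert one_pow M using 1
    rw [pow_two, Matrix.mul_fin_two, Matrix.mul_fin_two, Matrix.one_fin_two]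
    simp only [mul_zero, zero_mul, add_zero, zero_add]
    have : ∀ i j, ((e i : ℤ) : A) * ((e j : ℤ) : A) * (((e i : ℤ) : A) * ((e j : ℤ) : A)) = 1 :=
      fun i j => by linear_combination ((e j : ℤ) : A) * ((e j : ℤ) : A) * he i + he j
    rw [this, this]

end

/-! ### Linear independence of the spanning monomials -/

open Polynomial in
-- The remainder of `q` modulo `s`, composed with `g`, is divisible by `s.comp g` but has smaller
-- degree, so it vanishes.
theorem dvd_of_comp_dvd_comp {R : Type} [CommRing R] [IsDomain R] {s q g : R[X]} (hs : s.Monic)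
    (hg : 0 < g.natDegree) (h : s.comp g ∣ q.comp g) : s ∣ q := by
  rw [← modByMonic_eq_zero_iff_dvd hs]
  by_contra hne
  have h1 : s.comp g ∣ (q %ₘ s).comp g := by
    have e : (q %ₘ s).comp g = q.comp g - s.comp g * (q /ₘ s).comp g := by
      rw [← mul_comp, ← sub_comp, modByMonic_eq_sub_mul_div q s]
    rw [e]
    exact dvd_sub h (dvd_mul_right _ _)
  have h2 : (q %ₘ s).natDegree < s.natDegree := by
    refine natDegree_modByMonic_lt q hs ?_
    rintro rfl
    exact hne (modByMonic_one q)
  have h3 := eq_zero_of_dvd_of_natDegree_lt h1 (by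
    rw [natDegree_comp, natDegree_comp]
    exact (Nat.mul_lt_mul_right hg).2 h2)
  rw [comp_eq_zero_iff] at h3
  rcases h3 with h3 | ⟨-, h3⟩
  · exact hne h3
  · rw [h3, natDegree_C] at hg
    exact hg.false

open Polynomial Chebyshev in
/-- A polynomial of degree at most `M` which vanishes at `2`, `-2` and modulo the Chebyshev
polynomial of degree `M - 1` is zero. -/
theorem eq_zero_of_chebyshev_S_dvd {R : Type} [CommRing R] [IsDomain R] [CharZero R] {M : ℕ}
    (hM : 1 ≤ M) {q : R[X]} (hq : q.natDegree ≤ M) (h2 : q.eval 2 = 0) (hm2 : q.eval (-2) = 0)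
    (hdvd : S R (M - 1) ∣ q) : q = 0 := by
  classical
  obtain ⟨M, rfl⟩ : ∃ k, M = k + 1 := ⟨M - 1, by omega⟩
  rw [Nat.cast_succ, add_sub_cancel_right] at hdvd
  obtain ⟨p, rfl⟩ := hdvd
  obtain ⟨hmon, hdeg⟩ := monic_chebyshev_S R M
  by_cases hp : p = 0
  · rw [hp, mul_zero]
  exfalso
  -- The cofactor `p` has degree at most one, and the Chebyshev factor takes the values `±(M + 1)`
  -- at `±2`, nonzero in characteristic zero. So `p` would have the two roots `2` and `-2`.
  have hp1 : p.natDegree ≤ 1 := by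
    rw [hmon.natDegree_mul' hp, hdeg] at hq
    omega
  have hM0 : ((M : ℤ) : R) + 1 ≠ 0 := by exact_mod_cast Nat.succ_ne_zero M
  rw [eval_mul, S_eval_two, mul_eq_zero, or_iff_right hM0] at h2
  rw [eval_mul, S_eval_neg_two, mul_eq_zero, or_iff_right (mul_ne_zero ?_ hM0)] at hm2
  · refine hp (eq_zero_of_natDegree_lt_card_of_eval_eq_zero' p ({2, -2} : Finset R) ?_ ?_)
    · simp [h2, hm2]
    · have : (2 : R) ≠ -2 := by
        intro h
        have : (4 : R) = 0 := by linear_combination h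
        norm_num at this
      rw [Finset.card_pair this]
      omega
  · exact_mod_cast Units.ne_zero _

open Polynomial Chebyshev in
/-- The modulus of the ring over which the generic representation lives. -/
def testPoly (R : Type) [CommRing R] (M : ℕ) : R[X] := X * (S R (M - 1)).comp (X ^ 2 + 2)

/-- The value of a combination of the spanning monomials at a point. -/
def normalForm {R A : Type} [CommRing R] [CommRing A] [Algebra R A] {M : ℕ}
    (c : Fin 8 ⊕ Fin (M + 1) → R) (x y z α β : A) : A :=
  c (.inl 0) • x + c (.inl 1) • y + c (.inl 2) • α + c (.inl 3) • β + c (.inl 4) • (α * β) +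
    c (.inl 5) • (x * y) + c (.inl 6) • (x * z) + c (.inl 7) • (y * z) +
    ∑ i : Fin (M + 1), c (.inr i) • z ^ (i : ℕ)

theorem PseudoRing.lift_monomials {R A : Type} [CommRing R] [CommRing A] [Algebra R A] {M : ℕ}
    {x y z α β : A} (h : IsPseudoPoint M x y z α β) (c : Fin 8 ⊕ Fin (M + 1) → R) :
    PseudoRing.lift h (∑ i, c i • PseudoRing.monomials R M i) = normalForm c x y z α β := by
  rw [Fintype.sum_sum_type, map_add, map_sum, map_sum]
  simp only [map_smul, monomials, Sum.elim_inl, Sum.elim_inr, map_pow, lift_coord]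
  rw [normalForm]
  congr 1
  simp [Fin.sum_univ_succ, lift_coord]
  ring

open Polynomial in
-- At points with `x = y = 0` and `α = β = -1` the combination becomes `P(z) + k`, with `P`
-- collecting the powers of `z`. The generic point makes `S_{M-1}` divide `P + k`, and two diagonal
-- points make it vanish at `z = ±2`; since its degree is at most `M`, it is zero. The other
-- diagonal points then give a finite linear system for the remaining eight coefficients.
theorem normalForm_injective {R : Type} [CommRing R] [IsDomain R] [CharZero R] {M : ℕ}
    (hM : 1 ≤ M) (c : Fin 8 ⊕ Fin (M + 1) → R)
    (hd : ∀ e : Fin 4 → ℤˣ, normalForm c (((e 0 : ℤ) : R) + (e 1 : ℤ)) ((e 2 : ℤ) + (e 3 : ℤ))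
      ((e 0 : ℤ) * (e 2 : ℤ) + (e 1 : ℤ) * (e 3 : ℤ)) ((e 0 : ℤ) * (e 1 : ℤ))
      ((e 2 : ℤ) * (e 3 : ℤ)) = 0)
    (hg : testPoly R M ∣ normalForm c 0 0 (X ^ 2 + 2) (-1) (-1)) : c = 0 := by
  set P : R[X] := ∑ i : Fin (M + 1), C (c (.inr i)) * X ^ (i : ℕ) with hP
  have hPe : ∀ t : R, ∑ i : Fin (M + 1), c (.inr i) • t ^ (i : ℕ) = P.eval t := fun t => by
    simp [hP, eval_finsetSum]
  set k : R := -c (.inl 2) - c (.inl 3) + c (.inl 4) with hk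
  have hq : P + C k = 0 := by
    refine eq_zero_of_chebyshev_S_dvd hM ?_ ?_ ?_ ?_
    · refine (natDegree_add_le _ _).trans (max_le (natDegree_sum_le_of_forall_le _ _ fun i _ => ?_)
        (by simp))
      exact (natDegree_C_mul_X_pow_le _ _).trans (by omega)
    -- These signs have `x = y = 0`, `α = β = -1` and `z = 2`; the next choice has `z = -2`.
    · have := hd ![1, -1, 1, -1]
      simp only [normalForm, hPe] at this
      simp at this
      rw [eval_add, eval_C, hk, ← this]
      norm_num
      ring
    · have := hd ![1, -1, -1, 1]
      simp only [normalForm, hPe] at this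
      simp at this
      rw [eval_add, eval_C, hk, ← this]
      norm_num
      ring
    · have hdeg : 0 < (X ^ 2 + 2 : R[X]).natDegree := by
        rw [show (X ^ 2 + 2 : R[X]) = X ^ 2 + C 2 by rw [map_ofNat], natDegree_X_pow_add_C]
        norm_num
      refine dvd_of_comp_dvd_comp ?_ hdeg ((dvd_mul_left _ _).trans (hg.trans (dvd_of_eq ?_)))
      · have := (monic_chebyshev_S R (M - 1)).1
        rwa [Nat.cast_sub hM, Nat.cast_one] at this
      · simp only [normalForm, smul_eq_C_mul, hP, hk]
        simp
        ring
  have hP' : ∀ i : Fin (M + 1), (P + C k).coeff i = c (.inr i) + if (i : ℕ) = 0 then k else 0 := by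
    intro i
    rw [coeff_add, coeff_C, hP, finsetSum_coeff]
    congr 1
    simp only [coeff_C_mul_X_pow]
    rw [Finset.sum_eq_single i]
    · simp
    · intro j _ hj
      rw [if_neg]
      exact fun h => hj (Fin.ext h.symm)
    · simp
  have hv : ∀ t : R, P.eval t = -k := fun t => by
    have := congrArg (eval t) hq
    rw [eval_add, eval_C, eval_zero] at this
    linear_combination this
  have key : ∀ e : Fin 4 → ℤˣ, _ := fun e => hd e
  simp only [normalForm, hPe, hv] at key
  have k1 := key ![1, 1, 1, 1]
  have k2 := key ![1, 1, -1, -1]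
  have k3 := key ![-1, -1, 1, 1]
  have k4 := key ![-1, -1, -1, -1]
  have k5 := key ![1, 1, 1, -1]
  have k6 := key ![-1, -1, 1, -1]
  have k7 := key ![1, -1, 1, 1]
  have k8 := key ![1, -1, -1, -1]
  simp at k1 k2 k3 k4 k5 k6 k7 k8
  -- The system is solved up to the factors `4` and `16`. They are not units in `ℤ_[2]`, but
  -- independence only needs that they can be cancelled.
  have cancel : ∀ (n : ℕ) (r : R), ((n + 1 : ℕ) : R) * r = 0 → r = 0 := fun n r h =>
    (mul_eq_zero.1 h).resolve_left (by exact_mod_cast Nat.succ_ne_zero n)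
  have c0 : c (.inl 0) = 0 := cancel 3 _ (by push_cast; linear_combination k5 - k6)
  have c1 : c (.inl 1) = 0 := cancel 3 _ (by push_cast; linear_combination k7 - k8)
  have c5 : c (.inl 5) = 0 := cancel 15 _ (by push_cast; linear_combination k1 - k2 - k3 + k4)
  have c6 : c (.inl 6) = 0 :=
    cancel 15 _ (by push_cast; linear_combination k1 - k2 + k3 - k4 - 8 * c1)
  have c7 : c (.inl 7) = 0 :=
    cancel 15 _ (by push_cast; linear_combination k1 + k2 - k3 - k4 - 8 * c0)
  have c2 : c (.inl 2) = 0 := cancel 15 _ (by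
    push_cast; linear_combination k1 + k2 + k3 + k4 + 2 * (k5 + k6) - 2 * (k7 + k8) + 16 * hk)
  have c3 : c (.inl 3) = 0 := cancel 15 _ (by
    push_cast; linear_combination k1 + k2 + k3 + k4 - 2 * (k5 + k6) + 2 * (k7 + k8) + 16 * hk)
  have c4 : c (.inl 4) = 0 := cancel 3 _ (by
    push_cast; linear_combination 4 * c2 - k5 - k6 + 16 * hk)
  have hk0 : k = 0 := by rw [hk, c2, c3, c4]; ring
  funext i
  rcases i with i | i
  · fin_cases i
    exacts [c0, c1, c2, c3, c4, c5, c6, c7]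
  · have := hP' i
    rw [hq, hk0] at this
    simpa using this.symm

open Polynomial Chebyshev in
theorem testPoly_monic (R : Type) [CommRing R] [Nontrivial R] {M : ℕ} (hM : 1 ≤ M) :
    (testPoly R M).Monic := by
  have h := (monic_chebyshev_S R (M - 1)).1
  rw [Nat.cast_sub hM, Nat.cast_one] at h
  have e : (X ^ 2 + 2 : R[X]) = X ^ 2 + C 2 := by rw [map_ofNat]
  refine monic_X.mul (h.comp ?_ ?_)
  · rw [e]
    exact monic_X_pow_add_C 2 two_ne_zero
  · rw [e, natDegree_X_pow_add_C]
    exact two_ne_zero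

/-- A ring over which the generic representation of the dihedral group is defined. -/
abbrev TestRing (R : Type) [CommRing R] (M : ℕ) : Type := AdjoinRoot (testPoly R M)

open Polynomial Chebyshev in
theorem TestRing.root_mul_eval (R : Type) [CommRing R] (M : ℕ) :
    AdjoinRoot.root (testPoly R M) *
      (S (TestRing R M) (M - 1)).eval (AdjoinRoot.root (testPoly R M) ^ 2 + 2) = 0 := by
  have h := AdjoinRoot.eval₂_root (testPoly R M)
  rw [testPoly, eval₂_mul, eval₂_X, eval₂_comp, eval₂_add, eval₂_pow, eval₂_X, eval₂_ofNat,
    eval₂_eq_eval_map, map_S] at h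
  exact h

theorem map_normalForm {R A B : Type} [CommRing R] {M : ℕ} [CommRing A] [Algebra R A] [CommRing B] [Algebra R B]
    (φ : A →ₐ[R] B) (c : Fin 8 ⊕ Fin (M + 1) → R) (x y z α β : A) :
    φ (normalForm c x y z α β) = normalForm c (φ x) (φ y) (φ z) (φ α) (φ β) := by
  simp [normalForm]

section

variable {R : Type} [CommRing R] {M : ℕ} [NeZero M]

/-- The homomorphism from the universal ring given by a determinant. -/
def PseudoRing.ofDet {A : Type} [CommRing A] [Algebra R A]
    (D : Determinant A (DihedralGroup (2 * M)) 2) : PseudoRing R M →ₐ[R] A :=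
  PseudoRing.lift (D.isPseudoPoint NeZero.one_le rfl)

theorem PseudoRing.ofDet_coord {A : Type} [CommRing A] [Algebra R A]
    (D : Determinant A (DihedralGroup (2 * M)) 2) (i : Fin 5) :
    PseudoRing.ofDet (R := R) D (coord R M i) = ![D.tr (.sr 0), D.tr (.sr 1), D.tr (.r 1),
      D.nm (.sr 0), D.nm (.sr 1)] i :=
  PseudoRing.lift_coord _ i

theorem PseudoRing.comp_ofDet {A B : Type} [CommRing A] [Algebra R A] [CommRing B] [Algebra R B]
    (φ : A →ₐ[R] B) (D : Determinant A (DihedralGroup (2 * M)) 2)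
    (D' : Determinant B (DihedralGroup (2 * M)) 2) (h : D.IsBaseChange (φ : A →+* B) D') :
    φ.comp (PseudoRing.ofDet D) = PseudoRing.ofDet D' := by
  obtain ⟨ht, hn⟩ := (D.isBaseChange_iff _ _).1 h
  refine PseudoRing.algHom_ext fun i => ?_
  rw [AlgHom.comp_apply, ofDet_coord, ofDet_coord]
  fin_cases i
  exacts [ht _, ht _, ht _, hn _, hn _]

theorem Determinant.isBaseChange_ofRep {A B G : Type} [CommRing A] [CommRing B] [Group G]
    [Fintype G] (φ : A →+* B) (ρ : G →* GL (Fin 2) A) :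
    (Determinant.ofRep ρ).IsBaseChange φ
      (Determinant.ofRep ((Matrix.GeneralLinearGroup.map φ).comp ρ)) := by
  rw [isBaseChange_iff]
  refine ⟨fun g => ?_, fun g => ?_⟩
  · rw [tr_ofRep, tr_ofRep]
    exact AddMonoidHom.map_trace φ _
  · rw [nm_ofRep, nm_ofRep]
    exact RingHom.map_det φ _

theorem PseudoRing.ofDet_monomials {A : Type} [CommRing A] [Algebra R A]
    (D : Determinant A (DihedralGroup (2 * M)) 2) (c : Fin 8 ⊕ Fin (M + 1) → R) :
    PseudoRing.ofDet D (∑ i, c i • PseudoRing.monomials R M i) =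
      normalForm c (D.tr (.sr 0)) (D.tr (.sr 1)) (D.tr (.r 1)) (D.nm (.sr 0)) (D.nm (.sr 1)) :=
  PseudoRing.lift_monomials _ c

open DihedralGroup in
theorem sr_zero_mul_sr_one (m : ℕ) : (sr 0 * sr 1 : DihedralGroup m) = r 1 := by
  rw [sr_mul_sr, sub_zero]

open DihedralGroup in
theorem isLifting_one_of_generators {A : Type} [CommRing A] {p m : ℕ} (π : A →+* ZMod p)
    (ρ : DihedralGroup m →* GL (Fin 2) A)
    (h0 : ((ρ (sr 0) : GL (Fin 2) A) : Matrix (Fin 2) (Fin 2) A).map π = 1)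
    (h1 : ((ρ (sr 1) : GL (Fin 2) A) : Matrix (Fin 2) (Fin 2) A).map π = 1) :
    IsLifting 1 π ρ :=
  dihedral_hom_ext (Units.ext h0) (Units.ext h1)

open DihedralGroup Polynomial in
/-- The traces and norms of the liftings of the trivial representation to the test ring separate
the combinations of the spanning monomials. -/
theorem eq_zero_of_ofDet_monomials [IsDomain R] [CharZero R] (π : TestRing R M →+* ZMod 2)
    (hπ : π (AdjoinRoot.root _) = 0) (c : Fin 8 ⊕ Fin (M + 1) → R)
    (hc : ∀ ρ : DihedralGroup (2 * M) →* GL (Fin 2) (TestRing R M), IsLifting 1 π ρ →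
      PseudoRing.ofDet (Determinant.ofRep ρ) (∑ i, c i • PseudoRing.monomials R M i) = 0) :
    c = 0 := by
  have : Nontrivial (TestRing R M) := π.domain_nontrivial
  have hM : 1 ≤ M := NeZero.one_le
  -- The diagonal representations are also taken over the test ring, to match the hypothesis `hc`.
  -- Freeness makes `R` a subring of it, so the resulting equations hold in `R`.
  have : Module.Free R (TestRing R M) := (testPoly_monic R hM).free_adjoinRoot
  have hinj : Function.Injective (algebraMap R (TestRing R M)) := FaithfulSMul.algebraMap_injective _ _
  refine normalForm_injective hM c (fun e => ?_) ?_
  · obtain ⟨ρ, h0, h1⟩ := exists_diagonal_rep (TestRing R M) M e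
    have hl : IsLifting 1 π ρ := by
      have he : ∀ i, (((e i : ℤ)) : ZMod 2) = 1 := fun i => by
        rcases Int.units_eq_one_or (e i) with h | h <;> rw [h] <;> decide
      apply isLifting_one_of_generators
      · rw [h0]; ext i j; fin_cases i <;> fin_cases j <;> simp [he]
      · rw [h1]; ext i j; fin_cases i <;> fin_cases j <;> simp [he]
    have h := hc ρ hl
    rw [PseudoRing.ofDet_monomials] at h
    simp only [Determinant.tr_ofRep, Determinant.nm_ofRep, ← sr_zero_mul_sr_one, map_mul,
      Units.val_mul, h0, h1] at h
    apply hinj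
    rw [map_zero, ← Algebra.ofId_apply, map_normalForm, ← h]
    simp [Algebra.ofId_apply, Matrix.trace_fin_two]
  · obtain ⟨ρ, h0, h1⟩ := exists_generic_rep (TestRing.root_mul_eval R M)
    have hl : IsLifting 1 π ρ := by
      have he : (-1 : ZMod 2) = 1 := by decide
      apply isLifting_one_of_generators
      · rw [h0]; ext i j; fin_cases i <;> fin_cases j <;> simp [he, hπ]
      · rw [h1]; ext i j; fin_cases i <;> fin_cases j <;> simp [he, hπ]
    have h := hc ρ hl
    rw [PseudoRing.ofDet_monomials] at h
    simp only [Determinant.tr_ofRep, Determinant.nm_ofRep, ← sr_zero_mul_sr_one, map_mul,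
      Units.val_mul, h0, h1] at h
    rw [← AdjoinRoot.mk_eq_zero]
    change AdjoinRoot.mkₐ _ _ = 0
    rw [map_normalForm, ← h]
    congr 1 <;> simp [Matrix.trace_fin_two]
    rw [map_ofNat]
    ring

end

/-! ### The universal determinant -/

section

/-- A family of representations over `A` as a representation over the product. -/
def piRep {ι A G : Type} [CommRing A] [Group G] {d : ℕ} (ρ : ι → G →* GL (Fin d) A) :
    G →* GL (Fin d) (ι → A) :=
  MonoidHom.toHomUnits
    { toFun := fun g => Matrix.of fun i j k => (ρ k g : Matrix (Fin d) (Fin d) A) i j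
      map_one' := by
        ext i j k
        by_cases h : i = j <;> simp [h, Matrix.one_apply]
      map_mul' := fun g h => by
        ext i j k
        simp [Matrix.mul_apply] }

theorem map_piRep {ι A G : Type} [CommRing A] [Group G] {d : ℕ} (ρ : ι → G →* GL (Fin d) A)
    (k : ι) : (Matrix.GeneralLinearGroup.map (Pi.evalRingHom (fun _ => A) k)).comp (piRep ρ) =
      ρ k := by
  ext g i j
  rfl

open DihedralGroup in
/-- The determinant whose values on the generators are the coordinates. -/
def PseudoRing.IsUniversalDet {R : Type} [CommRing R] {M : ℕ}
    (D : Determinant (PseudoRing R M) (DihedralGroup (2 * M)) 2) : Prop :=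
  D.tr (sr 0) = coord R M 0 ∧ D.tr (sr 1) = coord R M 1 ∧ D.tr (r 1) = coord R M 2 ∧
    D.nm (sr 0) = coord R M 3 ∧ D.nm (sr 1) = coord R M 4

section

variable {R : Type} [CommRing R] [IsDomain R] [CharZero R] {M : ℕ} [NeZero M]
  (π : TestRing R M →+* ZMod 2) (hπ : π (AdjoinRoot.root _) = 0)

include hπ

/-- The liftings of the trivial representation to the test ring are jointly faithful. -/
theorem PseudoRing.eq_zero_of_ofDet (f : PseudoRing R M)
    (hf : ∀ ρ : DihedralGroup (2 * M) →* GL (Fin 2) (TestRing R M), IsLifting 1 π ρ →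
      PseudoRing.ofDet (R := R) (Determinant.ofRep ρ) f = 0) : f = 0 := by
  have hs : f ∈ Submodule.span R (Set.range (PseudoRing.monomials R M)) := by
    rw [PseudoRing.span_monomials R NeZero.one_le]
    trivial
  obtain ⟨c, rfl⟩ := (Submodule.mem_span_range_iff_exists_fun R).1 hs
  rw [eq_zero_of_ofDet_monomials π hπ c hf]
  simp

theorem PseudoRing.exists_linearEquiv : Nonempty (PseudoRing R M ≃ₗ[R] (Fin (M + 9) → R)) := by
  have hli : LinearIndependent R (PseudoRing.monomials R M) := by
    rw [Fintype.linearIndependent_iff]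
    intro c hc i
    rw [eq_zero_of_ofDet_monomials π hπ c fun ρ _ => by rw [hc, map_zero]]
    rfl
  let b := Module.Basis.mk hli (PseudoRing.span_monomials R NeZero.one_le).ge
  let e : Fin 8 ⊕ Fin (M + 1) ≃ Fin (M + 9) := finSumFinEquiv.trans (finCongr (by omega))
  exact ⟨b.equivFun.trans (LinearEquiv.funCongrLeft R R e.symm)⟩

open DihedralGroup in
/-- The universal determinant. -/
theorem PseudoRing.exists_determinant :
    ∃ D : Determinant (PseudoRing R M) (DihedralGroup (2 * M)) 2, IsUniversalDet D := by
  -- The product of all liftings to the test ring is faithful on `PseudoRing`, so its determinant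
  -- can be descended along the injection `φ`.
  let ι := {ρ : DihedralGroup (2 * M) →* GL (Fin 2) (TestRing R M) // IsLifting 1 π ρ}
  let ρ := piRep (fun k : ι => k.1)
  let D := Determinant.ofRep ρ
  let φ : PseudoRing R M →ₐ[R] (ι → TestRing R M) := PseudoRing.ofDet D
  have hφ : Function.Injective φ := by
    rw [injective_iff_map_eq_zero]
    intro f hf
    refine PseudoRing.eq_zero_of_ofDet π hπ f fun ρ' hρ' => ?_
    have h := PseudoRing.comp_ofDet (Pi.evalAlgHom R (fun _ : ι => TestRing R M) ⟨ρ', hρ'⟩) D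
      (Determinant.ofRep ρ') (by
        have := Determinant.isBaseChange_ofRep
          (Pi.evalRingHom (fun _ : ι => TestRing R M) ⟨ρ', hρ'⟩) ρ
        rwa [map_piRep] at this)
    rw [← h, AlgHom.comp_apply, hf, map_zero]
  have hx := PseudoRing.ofDet_coord (R := R) D
  have h0 : φ (coord R M 0) = D.tr (sr 0) := hx 0
  have h1 : φ (coord R M 1) = D.tr (sr 1) := hx 1
  have h2 : φ (coord R M 2) = D.tr (r 1) := hx 2
  have h3 : φ (coord R M 3) = D.nm (sr 0) := hx 3
  have h4 : φ (coord R M 4) = D.nm (sr 1) := hx 4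
  -- All traces and norms lie in the image of `φ`, because recurrences and powers express them by
  -- the five coordinates.
  obtain ⟨D', hD'⟩ := Determinant.exists_isBaseChange_of_injective (φ : PseudoRing R M →+* _) hφ D
    (by
      rintro (i | i)
      · refine ⟨lucas (coord R M 3 * coord R M 4) (coord R M 2) 2 (coord R M 2) i.val, ?_⟩
        rw [map_lucas, ← ZMod.natCast_zmod_val i, Determinant.tr_r, ZMod.natCast_zmod_val]
        simp only [RingHom.coe_coe, map_mul, map_ofNat, h2, h3, h4]
      · refine ⟨lucas (coord R M 3 * coord R M 4) (coord R M 2) (coord R M 0) (coord R M 1) i.val,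
          ?_⟩
        rw [map_lucas, ← ZMod.natCast_zmod_val i, Determinant.tr_sr, ZMod.natCast_zmod_val]
        simp only [RingHom.coe_coe, map_mul, h0, h1, h2, h3, h4])
    (by
      rintro (i | i)
      · refine ⟨(coord R M 3 * coord R M 4) ^ i.val, ?_⟩
        rw [← ZMod.natCast_zmod_val i, Determinant.nm_r, ZMod.natCast_zmod_val]
        simp only [RingHom.coe_coe, map_mul, map_pow, h3, h4]
      · refine ⟨coord R M 3 * (coord R M 3 * coord R M 4) ^ i.val, ?_⟩
        rw [← ZMod.natCast_zmod_val i, Determinant.nm_sr, ZMod.natCast_zmod_val]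
        simp only [RingHom.coe_coe, map_mul, map_pow, h3, h4])
  obtain ⟨ht, hn⟩ := (D'.isBaseChange_iff _ _).1 hD'
  exact ⟨D', hφ ((ht _).trans h0.symm), hφ ((ht _).trans h1.symm), hφ ((ht _).trans h2.symm),
    hφ ((hn _).trans h3.symm), hφ ((hn _).trans h4.symm)⟩

end

section

open DihedralGroup

variable {R : Type} [CommRing R] {M : ℕ} [NeZero M]

/-- Together with `algHom_eq_ofDet` this makes `D` universal among determinants over arbitrary
`R`-algebras, without locality or completeness. -/
theorem PseudoRing.isBaseChange_ofDet {D : Determinant (PseudoRing R M) (DihedralGroup (2 * M)) 2}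
    (hD : IsUniversalDet D)
    {A : Type} [CommRing A] [Algebra R A] (D' : Determinant A (DihedralGroup (2 * M)) 2) :
    D.IsBaseChange ((PseudoRing.ofDet D' : PseudoRing R M →ₐ[R] A) : PseudoRing R M →+* A) D' := by
  have hx := PseudoRing.ofDet_coord (R := R) D'
  obtain ⟨h0, h1, h2, h3, h4⟩ := hD
  refine Determinant.isBaseChange_of_generators D _ D' ?_ ?_ ?_ ?_ ?_
  · rw [h0]; exact hx 0
  · rw [h1]; exact hx 1
  · rw [h2]; exact hx 2
  · rw [h3]; exact hx 3
  · rw [h4]; exact hx 4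

theorem PseudoRing.algHom_eq_ofDet {D : Determinant (PseudoRing R M) (DihedralGroup (2 * M)) 2}
    (hD : IsUniversalDet D)
    {A : Type} [CommRing A] [Algebra R A] (D' : Determinant A (DihedralGroup (2 * M)) 2)
    (φ : PseudoRing R M →ₐ[R] A) (h : D.IsBaseChange (φ : PseudoRing R M →+* A) D') :
    φ = PseudoRing.ofDet D' := by
  obtain ⟨ht, hn⟩ := (D.isBaseChange_iff _ _).1 h
  obtain ⟨h0, h1, h2, h3, h4⟩ := hD
  refine PseudoRing.algHom_ext fun i => ?_
  rw [ofDet_coord]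
  fin_cases i
  · exact (congrArg φ h0).symm.trans (ht _)
  · exact (congrArg φ h1).symm.trans (ht _)
  · exact (congrArg φ h2).symm.trans (ht _)
  · exact (congrArg φ h3).symm.trans (hn _)
  · exact (congrArg φ h4).symm.trans (hn _)

end

end

/-! ### Complete local rings that are finite over the p-adic integers -/

/-- For a finite module the completion is a quotient of the completion of `R` tensored with `M`, and
`R` surjects onto its own completion. -/
theorem isPrecomplete_of_finite {R M : Type} [CommRing R] [AddCommGroup M] [Module R M]
    (I : Ideal R) [IsPrecomplete I R] [Module.Finite R M] : IsPrecomplete I M := by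
  rw [← AdicCompletion.of_surjective_iff]
  intro y
  obtain ⟨z, rfl⟩ := AdicCompletion.ofTensorProduct_surjective_of_finite I M y
  induction z with
  | zero => exact ⟨0, by simp⟩
  | add z w hz hw =>
    obtain ⟨a, ha⟩ := hz
    obtain ⟨b, hb⟩ := hw
    exact ⟨a + b, by rw [map_add, map_add, ha, hb]⟩
  | tmul r x =>
    obtain ⟨s, rfl⟩ := AdicCompletion.of_surjective I R r
    refine ⟨s • x, ?_⟩
    rw [AdicCompletion.ofTensorProduct_tmul]
    ext n
    simp [AdicCompletion.smul_eval]
    rfl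

theorem isPrecomplete_of_pow_le {A : Type} [CommRing A] {I J : Ideal A} [h : IsPrecomplete I A]
    (hIJ : I ≤ J) {N : ℕ} (hJI : J ^ N ≤ I) : IsPrecomplete J A := by
  -- A `J`-adic Cauchy sequence has the `I`-adic Cauchy subsequence with indices `(N + 1) * n`. The
  -- factor `N + 1` instead of `N` keeps these indices at least `n`, also when `N = 0`.
  have hJI' : J ^ (N + 1) ≤ I := (Ideal.pow_le_pow_right (Nat.le_succ N)).trans hJI
  refine ⟨fun f hf => ?_⟩
  obtain ⟨L, hL⟩ := h.prec (f := fun n => f ((N + 1) * n)) (fun {m n} hmn => by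
    refine SModEq.mono ?_ (hf (Nat.mul_le_mul_left (N + 1) hmn))
    rw [smul_eq_mul, smul_eq_mul, Ideal.mul_top, Ideal.mul_top, pow_mul]
    exact Ideal.pow_right_mono hJI' m)
  refine ⟨L, fun n => ?_⟩
  refine (hf (Nat.le_mul_of_pos_left n N.succ_pos)).trans (SModEq.mono ?_ (hL n))
  rw [smul_eq_mul, smul_eq_mul, Ideal.mul_top, Ideal.mul_top]
  exact Ideal.pow_right_mono hIJ n

section padic

variable {p : ℕ} [Fact p.Prime] {A : Type} [CommRing A] [Algebra ℤ_[p] A]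

theorem dvd_of_algebraMap_eq_zero (π : A →+* ZMod p) {c : ℤ_[p]}
    (hc : π (algebraMap ℤ_[p] A c) = 0) : (p : ℤ_[p]) ∣ c := by
  rw [← Ideal.mem_span_singleton, ← PadicInt.maximalIdeal_eq_span_p,
    IsLocalRing.mem_maximalIdeal]
  intro hu
  have := (hu.map (algebraMap ℤ_[p] A)).map π
  rw [hc] at this
  exact not_isUnit_zero this

/-- If an algebra is generated by elements which are constant modulo the radical of `(p)`, then
the kernel of its residue map is contained in this radical. -/
theorem ker_le_radical (π : A →+* ZMod p) (s : Set A) (hs : Algebra.adjoin ℤ_[p] s = ⊤)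
    (h : ∀ a ∈ s, ∃ c : ℤ_[p], a - algebraMap _ A c ∈ (Ideal.span {(p : A)}).radical) :
    RingHom.ker π ≤ (Ideal.span {(p : A)}).radical := by
  set J := (Ideal.span {(p : A)}).radical with hJ
  have hJπ : ∀ a ∈ J, π a = 0 := by
    rintro a ⟨n, hn⟩
    obtain ⟨b, hb⟩ := Ideal.mem_span_singleton.1 hn
    have := congrArg π hb
    rw [map_pow, map_mul, map_natCast, CharP.cast_eq_zero, zero_mul] at this
    exact (pow_eq_zero_iff (by rintro rfl; simp at this)).1 this
  -- It suffices that every element is a scalar modulo `J`: for an element of the kernel the scalar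
  -- is divisible by `p`, hence itself lies in `J`.
  have key : ∀ a : A, ∃ c : ℤ_[p], a - algebraMap _ A c ∈ J := by
    intro a
    have ha : a ∈ Algebra.adjoin ℤ_[p] s := hs ▸ Algebra.mem_top
    induction ha using Algebra.adjoin_induction with
    | mem a ha => exact h a ha
    | algebraMap c => exact ⟨c, by simp⟩
    | add a b _ _ ha hb =>
      obtain ⟨c, hc⟩ := ha
      obtain ⟨d, hd⟩ := hb
      refine ⟨c + d, ?_⟩
      rw [map_add, add_sub_add_comm]
      exact J.add_mem hc hd
    | mul a b _ _ ha hb =>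
      obtain ⟨c, hc⟩ := ha
      obtain ⟨d, hd⟩ := hb
      refine ⟨c * d, ?_⟩
      rw [map_mul, show a * b - algebraMap _ A c * algebraMap _ A d =
        b * (a - algebraMap _ A c) + algebraMap _ A c * (b - algebraMap _ A d) by ring]
      exact J.add_mem (J.mul_mem_left _ hc) (J.mul_mem_left _ hd)
  intro a ha
  obtain ⟨c, hc⟩ := key a
  have h1 := hJπ _ hc
  rw [map_sub, RingHom.mem_ker.1 ha, zero_sub, neg_eq_zero] at h1
  obtain ⟨d, rfl⟩ := dvd_of_algebraMap_eq_zero π h1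
  rw [map_mul, map_natCast] at hc
  have h2 : (p : A) * algebraMap _ A d ∈ J :=
    Ideal.le_radical (Ideal.mul_mem_right _ _ (Ideal.mem_span_singleton_self _))
  simpa using J.add_mem hc h2

variable [Module.Finite ℤ_[p] A]

/-- By integrality a maximal ideal lies over `(p)`, so it contains the radical of `(p)` and with it
the maximal ideal `RingHom.ker π`. -/
theorem isMaximal_eq_ker (π : A →+* ZMod p)
    (h : RingHom.ker π ≤ (Ideal.span {(p : A)}).radical) (I : Ideal A) (hI : I.IsMaximal) :
    I = RingHom.ker π := by
  have hker : (RingHom.ker π).IsMaximal :=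
    RingHom.ker_isMaximal_of_surjective π (ZMod.ringHom_surjective π)
  have hc : (I.comap (algebraMap ℤ_[p] A)).IsMaximal :=
    Ideal.isMaximal_comap_of_isIntegral_of_isMaximal I
  have hp : (p : A) ∈ I := by
    have h1 : (p : ℤ_[p]) ∈ I.comap (algebraMap ℤ_[p] A) := by
      rw [IsLocalRing.eq_maximalIdeal hc, PadicInt.maximalIdeal_eq_span_p]
      exact Ideal.mem_span_singleton_self _
    simpa using h1
  have hle : RingHom.ker π ≤ I := h.trans
    ((Ideal.radical_mono ((Ideal.span_singleton_le_iff_mem _).2 hp)).trans hI.isPrime.radical.le)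
  exact (hker.eq_of_le hI.ne_top hle).symm

theorem isLocalRing_of_ker_le_radical (π : A →+* ZMod p)
    (h : RingHom.ker π ≤ (Ideal.span {(p : A)}).radical) : IsLocalRing A :=
  IsLocalRing.of_unique_max_ideal ⟨RingHom.ker π,
    RingHom.ker_isMaximal_of_surjective π (ZMod.ringHom_surjective π), isMaximal_eq_ker π h⟩

theorem isNoetherianRing_of_finite (p : ℕ) [Fact p.Prime] (A : Type) [CommRing A]
    [Algebra ℤ_[p] A] [Module.Finite ℤ_[p] A] : IsNoetherianRing A :=
  isNoetherian_of_tower ℤ_[p] (isNoetherian_of_isNoetherianRing_of_finite ℤ_[p] A)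

/-- Finiteness over `ℤ_[p]` gives `p`-adic precompleteness. The inclusions `𝔪 ^ N ≤ (p) ≤ 𝔪`
transfer it to the maximal ideal `𝔪`. -/
theorem isAdicComplete_of_ker_le_radical [IsLocalRing A] (π : A →+* ZMod p)
    (h : RingHom.ker π ≤ (Ideal.span {(p : A)}).radical) :
    IsAdicComplete (IsLocalRing.maximalIdeal A) A := by
  have := isNoetherianRing_of_finite p A
  have hm : IsLocalRing.maximalIdeal A = RingHom.ker π :=
    isMaximal_eq_ker π h _ inferInstance
  have h1 : IsPrecomplete (IsLocalRing.maximalIdeal ℤ_[p]) A := isPrecomplete_of_finite _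
  rw [← IsPrecomplete.map_algebraMap_iff (S := A), PadicInt.maximalIdeal_eq_span_p, Ideal.map_span,
    Set.image_singleton, map_natCast] at h1
  obtain ⟨N, hN⟩ := Ideal.exists_pow_le_of_le_radical_of_fg h (Ideal.fg_of_isNoetherianRing _)
  have h2 : IsPrecomplete (IsLocalRing.maximalIdeal A) A := by
    refine isPrecomplete_of_pow_le (I := Ideal.span {(p : A)}) (N := N) ?_ (hm ▸ hN)
    rw [hm, Ideal.span_singleton_le_iff_mem, RingHom.mem_ker, map_natCast, CharP.cast_eq_zero]
  exact { h2, (inferInstance : IsHausdorff (IsLocalRing.maximalIdeal A) A) with }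

end padic

section residue

variable {p : ℕ} [Fact p.Prime] {A : Type} [CommRing A] [IsLocalRing A]

theorem ker_eq_maximalIdeal (π : A →+* ZMod p) : RingHom.ker π = IsLocalRing.maximalIdeal A :=
  IsLocalRing.eq_maximalIdeal
    (RingHom.ker_isMaximal_of_surjective π (ZMod.ringHom_surjective π))

theorem nontrivial_quotient_pow (n : ℕ) :
    Nontrivial (A ⧸ IsLocalRing.maximalIdeal A ^ (n + 1)) :=
  Ideal.Quotient.nontrivial_iff.2 fun h => (IsLocalRing.maximalIdeal.isMaximal A).ne_top
    (top_le_iff.1 (h.ge.trans (Ideal.pow_le_self n.succ_ne_zero)))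

theorem isLocalRing_quotient_pow (n : ℕ) :
    IsLocalRing (A ⧸ IsLocalRing.maximalIdeal A ^ (n + 1)) :=
  have := nontrivial_quotient_pow (A := A) n
  IsLocalRing.of_surjective' _ Ideal.Quotient.mk_surjective

theorem isArtinianRing_quotient_pow [IsNoetherianRing A] (n : ℕ) :
    IsArtinianRing (A ⧸ IsLocalRing.maximalIdeal A ^ (n + 1)) := by
  have := isLocalRing_quotient_pow (A := A) n
  rw [isArtinianRing_iff_isNilpotent_maximalIdeal]
  refine ⟨n + 1, ?_⟩
  have h : IsLocalRing.maximalIdeal (A ⧸ IsLocalRing.maximalIdeal A ^ (n + 1)) ≤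
      (IsLocalRing.maximalIdeal A).map (Ideal.Quotient.mk _) := by
    intro x hx
    obtain ⟨a, rfl⟩ := Ideal.Quotient.mk_surjective x
    refine Ideal.mem_map_of_mem _ ((IsLocalRing.mem_maximalIdeal a).2 fun ha => ?_)
    exact (IsLocalRing.mem_maximalIdeal _).1 hx (ha.map _)
  refine le_bot_iff.1 ((Ideal.pow_right_mono h _).trans ?_)
  rw [← Ideal.map_pow, Ideal.map_quotient_self]

/-- The residue map of a quotient by a power of the maximal ideal. -/
def residueQuotientPow (π : A →+* ZMod p) (n : ℕ) :
    A ⧸ IsLocalRing.maximalIdeal A ^ (n + 1) →+* ZMod p :=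
  Ideal.Quotient.lift _ π fun a ha => by
    have : a ∈ IsLocalRing.maximalIdeal A := Ideal.pow_le_self n.succ_ne_zero ha
    rwa [← ker_eq_maximalIdeal π] at this

theorem residueQuotientPow_comp (π : A →+* ZMod p) (n : ℕ) :
    (residueQuotientPow π n).comp (Ideal.Quotient.mk _) = π :=
  RingHom.ext fun _ => rfl

end residue

/-! ### Locality for 2-groups, and existence of the pseudodeformation ring -/

section

/-- From `tr g ^ 2 = tr (g ^ 2) + 2 * nm g`, induction on the exponent descends to `tr 1 = 2`. This
is where 2-power order matters. -/
theorem Determinant.tr_mem_radical {A G : Type} [CommRing A] [Group G] [Fintype G]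
    (D : Determinant A G 2) (n : ℕ) (g : G) (hg : g ^ 2 ^ n = 1) :
    D.tr g ∈ (Ideal.span {((2 : ℕ) : A)}).radical := by
  have h2 : (2 : A) ∈ (Ideal.span {((2 : ℕ) : A)}).radical := by
    rw [Nat.cast_ofNat]
    exact Ideal.le_radical (Ideal.mem_span_singleton_self _)
  induction n generalizing g with
  | zero =>
    rw [pow_zero, pow_one] at hg
    rwa [hg, tr_one]
  | succ n ih =>
    have h := D.tr_mul_tr g g
    rw [mul_inv_cancel, tr_one, ← pow_two, ← pow_two] at h
    have h' : D.tr g ^ 2 ∈ (Ideal.span {((2 : ℕ) : A)}).radical := by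
      rw [h]
      exact Ideal.add_mem _ (ih _ (by rwa [← pow_mul, ← pow_succ'])) (Ideal.mul_mem_right _ _ h2)
    exact (Ideal.radical_isRadical _) ⟨2, h'⟩

/-- Since `nm g ^ 2 = 1`, the square of `nm g - 1` is `2 * (1 - nm g)`. -/
theorem Determinant.nm_sub_one_mem_radical {A G : Type} [CommRing A] [Group G]
    (D : Determinant A G 2) (g : G) (hg : g * g = 1) :
    D.nm g - 1 ∈ (Ideal.span {((2 : ℕ) : A)}).radical := by
  have h := D.nm_mul g g
  rw [hg, nm_one] at h
  refine ⟨2, Ideal.mem_span_singleton.2 ⟨1 - D.nm g, ?_⟩⟩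
  push_cast
  linear_combination -h

theorem PseudoRing.adjoin_coord (R : Type) [CommRing R] (M : ℕ) :
    Algebra.adjoin R (Set.range (coord R M)) = ⊤ := by
  have h : coord R M = Ideal.Quotient.mkₐ R (Ideal.span (pseudoRelations R M)) ∘
    MvPolynomial.X := rfl
  rw [h, Set.range_comp, ← AlgHom.map_adjoin, MvPolynomial.adjoin_range_X, Algebra.map_top,
    AlgHom.range_eq_top]
  exact Ideal.Quotient.mkₐ_surjective _ _

section

variable (M : ℕ)

/-- The residue map of the test ring. -/
def residueTestRing : TestRing ℤ_[2] M →+* ZMod 2 :=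
  AdjoinRoot.lift PadicInt.toZMod 0 (by simp [testPoly])

theorem residueTestRing_root : residueTestRing M (AdjoinRoot.root _) = 0 :=
  AdjoinRoot.lift_root _

variable [NeZero M]

theorem finite_testRing : Module.Finite ℤ_[2] (TestRing ℤ_[2] M) :=
  (testPoly_monic ℤ_[2] (M := M) NeZero.one_le).finite_adjoinRoot

theorem PseudoRing.finite : Module.Finite ℤ_[2] (PseudoRing ℤ_[2] M) := by
  obtain ⟨e⟩ := PseudoRing.exists_linearEquiv (residueTestRing M) (residueTestRing_root M)
  exact Module.Finite.equiv e.symm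

/-- The residue map of the universal ring. -/
def PseudoRing.residue : PseudoRing ℤ_[2] M →+* ZMod 2 :=
  letI : Algebra ℤ_[2] (ZMod 2) := PadicInt.toZMod.toAlgebra
  (ofDet (R := ℤ_[2]) (Determinant.ofRep (1 : DihedralGroup (2 * M) →* GL (Fin 2) (ZMod 2))) :
    PseudoRing ℤ_[2] M →ₐ[ℤ_[2]] ZMod 2)

open DihedralGroup

variable {n : ℕ} (hn : 2 * M = 2 ^ n)

include hn

theorem PseudoRing.ker_residue_le :
    RingHom.ker (PseudoRing.residue M) ≤ (Ideal.span {((2 : ℕ) : PseudoRing ℤ_[2] M)}).radical := by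
  obtain ⟨D, h0, h1, h2, h3, h4⟩ :=
    PseudoRing.exists_determinant (residueTestRing M) (residueTestRing_root M)
  refine ker_le_radical _ _ (PseudoRing.adjoin_coord _ _) ?_
  have hn0 : n ≠ 0 := by
    rintro rfl
    omega
  obtain ⟨k, rfl⟩ := Nat.exists_eq_succ_of_ne_zero hn0
  have hsr : ∀ i : ZMod (2 * M), (sr i) ^ 2 ^ (k + 1) = 1 := fun i => by
    rw [pow_succ', pow_mul, pow_two, sr_mul_self, one_pow]
  have hr : (r 1 : DihedralGroup (2 * M)) ^ 2 ^ (k + 1) = 1 := by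
    rw [← hn, r_one_pow_n]
  rintro _ ⟨i, rfl⟩
  fin_cases i
  · exact ⟨0, by rw [map_zero, sub_zero]; exact h0 ▸ D.tr_mem_radical _ _ (hsr 0)⟩
  · exact ⟨0, by rw [map_zero, sub_zero]; exact h1 ▸ D.tr_mem_radical _ _ (hsr 1)⟩
  · exact ⟨0, by rw [map_zero, sub_zero]; exact h2 ▸ D.tr_mem_radical _ _ hr⟩
  · exact ⟨1, by rw [map_one]; exact h3 ▸ D.nm_sub_one_mem_radical _ (sr_mul_self 0)⟩
  · exact ⟨1, by rw [map_one]; exact h4 ▸ D.nm_sub_one_mem_radical _ (sr_mul_self 1)⟩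

/-- The generator `u` satisfies `u ^ 2 = tr (r 1) - 2` for the generic representation, so its square
lies in the radical. -/
theorem ker_residueTestRing_le :
    RingHom.ker (residueTestRing M) ≤ (Ideal.span {((2 : ℕ) : TestRing ℤ_[2] M)}).radical := by
  refine ker_le_radical _ _ (AdjoinRoot.adjoinRoot_eq_top (f := testPoly ℤ_[2] M)) ?_
  rintro _ rfl
  refine ⟨0, ?_⟩
  rw [map_zero, sub_zero]
  obtain ⟨ρ, h0, h1⟩ := exists_generic_rep (TestRing.root_mul_eval ℤ_[2] M)
  have hr := (Determinant.ofRep ρ).tr_mem_radical n (r 1) (by rw [← hn, r_one_pow_n])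
  rw [Determinant.tr_ofRep, ← sr_zero_mul_sr_one, map_mul, Units.val_mul, h0, h1] at hr
  have h2 : (2 : TestRing ℤ_[2] M) ∈ (Ideal.span {((2 : ℕ) : TestRing ℤ_[2] M)}).radical := by
    rw [Nat.cast_ofNat]
    exact Ideal.le_radical (Ideal.mem_span_singleton_self _)
  refine (Ideal.radical_isRadical _) ⟨2, ?_⟩
  convert Ideal.sub_mem _ hr h2 using 1
  simp [Matrix.trace_fin_two]
  ring

theorem PseudoRing.isLocalRing : IsLocalRing (PseudoRing ℤ_[2] M) :=
  have := PseudoRing.finite M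
  isLocalRing_of_ker_le_radical _ (PseudoRing.ker_residue_le M hn)

theorem isLocalRing_testRing : IsLocalRing (TestRing ℤ_[2] M) :=
  have := finite_testRing M
  isLocalRing_of_ker_le_radical _ (ker_residueTestRing_le M hn)

/-- `PseudoRing` classifies determinants over all `ℤ_[2]`-algebras; what remains is that it is
local, Noetherian and complete. -/
theorem exists_pseudoDeformationRing : Nonempty (PseudoDeformationRing 2
    (Determinant.ofRep (1 : DihedralGroup (2 * M) →* GL (Fin 2) (ZMod 2)))) := by
  have := PseudoRing.finite M
  have := PseudoRing.isLocalRing M hn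
  have := isNoetherianRing_of_finite 2 (PseudoRing ℤ_[2] M)
  have := isAdicComplete_of_ker_le_radical _ (PseudoRing.ker_residue_le M hn)
  obtain ⟨D, hD⟩ := PseudoRing.exists_determinant (residueTestRing M) (residueTestRing_root M)
  exact ⟨{
    R := PseudoRing ℤ_[2] M
    π := PseudoRing.residue M
    D := D
    isDeformation :=
      letI : Algebra ℤ_[2] (ZMod 2) := PadicInt.toZMod.toAlgebra
      PseudoRing.isBaseChange_ofDet hD _
    universal := fun A _ _ _ _ _ DA _ =>
      ⟨PseudoRing.ofDet DA, PseudoRing.isBaseChange_ofDet hD DA,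
        fun φ h => PseudoRing.algHom_eq_ofDet hD DA φ h⟩ }⟩

end

end

/-! ### Existence of the framed deformation ring -/

section completion

variable {C : Type} [CommRing C]

open MvPowerSeries in
/-- A completion of a Noetherian ring is a quotient of a ring of power series. -/
theorem isNoetherianRing_adicCompletion [IsNoetherianRing C] (I : Ideal C) :
    IsNoetherianRing (AdicCompletion I C) := by
  have hfg : I.FG := I.fg_of_isNoetherianRing
  obtain ⟨s, hs⟩ := id hfg
  let φ : MvPolynomial s C →+* C := MvPolynomial.aeval (R := C) (fun x : s => (x : C))
  have hφ : (MvPolynomial.idealOfVars s C).map φ = I := by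
    rw [MvPolynomial.idealOfVars, Ideal.map_span, ← Set.range_comp, ← hs]
    congr 1
    ext x
    simp [φ]
  have hpow : ∀ n, MvPolynomial.idealOfVars s C ^ n ≤ (I ^ n).comap φ := fun n => by
    rw [← Ideal.map_le_iff_le_comap, Ideal.map_pow, hφ]
  -- Modulo `I ^ n`, a power series is evaluated at the generators of `I` after truncation; these
  -- maps assemble to `F`.
  let f : (n : ℕ) → MvPowerSeries s C →+* C ⧸ I ^ n := fun n =>
    (Ideal.quotientMap (I ^ n) φ (hpow n)).comp (truncTotalAlgHom s C n).toRingHom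
  have hf : ∀ {m n : ℕ} (hle : m ≤ n), (Ideal.Quotient.factorPow I hle).comp (f n) = f m := by
    intro m n hle
    ext p
    change Ideal.Quotient.mk _ (φ _) = Ideal.Quotient.mk _ (φ _)
    rw [Ideal.Quotient.mk_eq_mk_iff_sub_mem, ← map_sub]
    exact hpow m (truncTotal_sub_truncTotal_mem_pow_idealOfVars hle le_rfl p)
  let F := AdicCompletion.liftRingHom I f hf
  have hF : ∀ q : MvPolynomial s C, F (algebraMap _ _ q) = algebraMap C _ (φ q) := by
    intro q
    refine AdicCompletion.ext_evalₐ fun n => ?_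
    rw [AdicCompletion.evalₐ_liftRingHom]
    change Ideal.quotientMap (I ^ n) φ (hpow n) (truncTotalAlgHom s C n (algebraMap _ _ q)) = _
    rw [AlgHom.commutes, AlgHom.commutes]
    rfl
  let J : Ideal (MvPowerSeries s C) := Ideal.span (Set.range X)
  have hJ : J.map F = I.map (algebraMap C (AdicCompletion I C)) := by
    have h1 : J = (MvPolynomial.idealOfVars s C).map (algebraMap _ (MvPowerSeries s C)) := by
      rw [MvPolynomial.idealOfVars, Ideal.map_span, ← Set.range_comp]
      exact congrArg (fun t => Ideal.span (Set.range t))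
        (funext fun x => (MvPolynomial.coe_X x).symm)
    have h2 : I.map (algebraMap C (AdicCompletion I C)) =
        (MvPolynomial.idealOfVars s C).map ((algebraMap C (AdicCompletion I C)).comp φ) := by
      rw [← Ideal.map_map, hφ]
    rw [h1, h2, Ideal.map_map]
    exact congrArg (fun θ => Ideal.map θ (MvPolynomial.idealOfVars s C)) (RingHom.ext hF)
  have hc := AdicCompletion.isAdicComplete_self I hfg
  have hh : IsHausdorff (J.map F) (AdicCompletion I C) := hJ ▸ hc.toIsHausdorff
  have hsurj : Function.Surjective F := by
    -- By completeness of the source and separatedness of the target, surjectivity can be tested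
    -- modulo `J`, where constants suffice because the quotient of the completion is `C ⧸ I`.
    refine surjective_of_mk_map_comp_surjective (I := J) F fun y => ?_
    obtain ⟨z, rfl⟩ := Ideal.Quotient.mk_surjective y
    obtain ⟨c, hc⟩ := Ideal.Quotient.mk_surjective (AdicCompletion.evalOneₐ I z)
    refine ⟨algebraMap (MvPolynomial s C) _ (MvPolynomial.C c), ?_⟩
    rw [RingHom.comp_apply, hF, Ideal.Quotient.mk_eq_mk_iff_sub_mem, hJ,
      ← AdicCompletion.ker_evalOneₐ_eq_map I hfg]
    change AdicCompletion.evalOneₐ I _ = 0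
    rw [map_sub, AlgHom.commutes, ← hc]
    simp [φ]
  exact isNoetherianRing_of_surjective _ _ F hsurj

end completion

/-- Every p-adic integer is a natural number modulo `p`. It follows that residue maps are
automatically `ℤ_[p]`-linear. -/
theorem padicInt_ringHom_ext {p : ℕ} [Fact p.Prime] (f : ℤ_[p] →+* ZMod p) :
    f = PadicInt.toZMod := by
  ext c
  have h : (p : ℤ_[p]) ∣ c - (PadicInt.toZMod c).val := by
    rw [← Ideal.mem_span_singleton, ← PadicInt.maximalIdeal_eq_span_p, ← PadicInt.ker_toZMod,
      RingHom.mem_ker, map_sub, map_natCast, ZMod.natCast_zmod_val, sub_self]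
  obtain ⟨b, hb⟩ := h
  have h' := congrArg f hb
  rw [map_sub, map_natCast, map_mul, map_natCast, CharP.cast_eq_zero (ZMod p) p, zero_mul,
    sub_eq_zero, ZMod.natCast_zmod_val] at h'
  exact h'

section

variable {G : Type} [Group G] {d : ℕ}

/-- The representations of a finite group in dimension `d` are classified by an algebra of finite
type. -/
theorem exists_universal_rep [Finite G] (K : Type) [CommRing K] [IsNoetherianRing K] (d : ℕ) :
    ∃ (C : Type) (_ : CommRing C) (_ : IsNoetherianRing C) (_ : Algebra K C)
      (ρ : G →* GL (Fin d) C), ∀ (A : Type) [CommRing A] [Algebra K A] (ρA : G →* GL (Fin d) A),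
      ∃! φ : C →ₐ[K] A, (Matrix.GeneralLinearGroup.map (φ : C →+* A)).comp ρ = ρA := by
  let X : G → Matrix (Fin d) (Fin d) (MvPolynomial (G × Fin d × Fin d) K) :=
    fun g => Matrix.of fun i j => MvPolynomial.X (g, i, j)
  let rel : Set (MvPolynomial (G × Fin d × Fin d) K) :=
    {f | (∃ i j, f = X 1 i j - (1 : Matrix (Fin d) (Fin d) _) i j) ∨
      ∃ g h i j, f = X (g * h) i j - (X g * X h) i j}
  obtain ⟨C, _, _, _, q, hqs, hq, hlift⟩ : ∃ (C : Type) (_ : CommRing C) (_ : IsNoetherianRing C)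
      (_ : Algebra K C) (q : MvPolynomial (G × Fin d × Fin d) K →ₐ[K] C),
      Function.Surjective q ∧ (∀ f ∈ rel, q f = 0) ∧
      ∀ (A : Type) [CommRing A] [Algebra K A] (φ₀ : MvPolynomial (G × Fin d × Fin d) K →ₐ[K] A),
        rel ⊆ RingHom.ker φ₀ → ∃ φ : C →ₐ[K] A, ∀ f, φ (q f) = φ₀ f :=
    ⟨_ ⧸ Ideal.span rel, inferInstance, inferInstance, inferInstance, Ideal.Quotient.mkₐ K _,
      Ideal.Quotient.mkₐ_surjective K _,
      fun f hf => Ideal.Quotient.eq_zero_iff_mem.2 (Ideal.subset_span hf),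
      fun A _ _ φ₀ h => ⟨Ideal.Quotient.liftₐ _ φ₀ fun a ha => Ideal.span_le.2 h ha,
        fun f => rfl⟩⟩
  let ρ : G →* GL (Fin d) C := MonoidHom.toHomUnits
    { toFun := fun g => (X g).map q
      map_one' := by
        ext i j
        have h := hq _ (Or.inl ⟨i, j, rfl⟩)
        rw [map_sub, sub_eq_zero] at h
        rw [Matrix.map_apply, h, ← Matrix.map_apply (f := q), Matrix.map_one q (map_zero _) (map_one _)]
      map_mul' := fun g g' => by
        ext i j
        have h := hq _ (Or.inr ⟨g, g', i, j, rfl⟩)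
        rw [map_sub, sub_eq_zero] at h
        rw [Matrix.map_apply, h, ← Matrix.map_apply (f := q), Matrix.map_mul] }
  have hρ : ∀ g i j, (ρ g : Matrix (Fin d) (Fin d) C) i j = q (MvPolynomial.X (g, i, j)) :=
    fun _ _ _ => rfl
  refine ⟨C, inferInstance, inferInstance, inferInstance, ρ, fun A _ _ ρA => ?_⟩
  let φ₀ : MvPolynomial (G × Fin d × Fin d) K →ₐ[K] A :=
    MvPolynomial.aeval fun x => (ρA x.1 : Matrix (Fin d) (Fin d) A) x.2.1 x.2.2
  have hX : ∀ g, (X g).map φ₀ = ρA g := fun g => by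
    ext i j
    exact MvPolynomial.aeval_X _ _
  obtain ⟨φ, hφ⟩ := hlift A φ₀ (by
    rintro f (⟨i, j, rfl⟩ | ⟨g, h, i, j, rfl⟩) <;> rw [SetLike.mem_coe, RingHom.mem_ker, map_sub,
      sub_eq_zero, ← Matrix.map_apply (f := φ₀), ← Matrix.map_apply (f := φ₀), hX]
    · rw [Matrix.map_one _ (map_zero _) (map_one _), map_one, Units.val_one]
    · rw [Matrix.map_mul, hX, hX, map_mul, Units.val_mul])
  refine ⟨φ, ?_, fun ψ hψ => ?_⟩
  · refine MonoidHom.ext fun g => Units.ext ?_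
    ext i j
    have h1 := congrFun (congrFun (hX g) i) j
    rw [← h1, Matrix.map_apply, ← hφ]
    rfl
  · have h : ψ.comp q = φ₀ := MvPolynomial.algHom_ext fun x => by
      rw [MvPolynomial.aeval_X, ← hψ]
      rfl
    ext c
    obtain ⟨f, rfl⟩ := hqs c
    exact (DFunLike.congr_fun h f).trans (hφ f).symm

/-- A completion of the algebra classifying all representations is a universal framed deformation
ring. -/
theorem exists_liftingRing [Finite G] {p : ℕ} [Fact p.Prime] (ρbar : G →* GL (Fin d) (ZMod p)) :
    Nonempty (LiftingRing p ρbar) := by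
  obtain ⟨C, _, _, _, ρC, hC⟩ := exists_universal_rep (G := G) ℤ_[p] d
  let _ : Algebra ℤ_[p] (ZMod p) := PadicInt.toZMod.toAlgebra
  obtain ⟨πC, hπC, hπC'⟩ := hC (ZMod p) ρbar
  -- `I` is the point of the representation scheme that corresponds to `ρbar`; the deformation ring
  -- is the completion there.
  set I := RingHom.ker (πC : C →+* ZMod p) with hI
  have hImax : I.IsMaximal :=
    RingHom.ker_isMaximal_of_surjective _ (ZMod.ringHom_surjective (πC : C →+* ZMod p))
  have hfg : I.FG := I.fg_of_isNoetherianRing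
  let R := AdicCompletion I C
  have hmax := AdicCompletion.isMaximal_map_of_le I I le_rfl hfg
  have hcomp := AdicCompletion.isAdicComplete_self I hfg
  have hloc : IsLocalRing R := isLocalRing_of_isAdicComplete_maximal (I.map (algebraMap C R))
  have hnoeth : IsNoetherianRing R := isNoetherianRing_adicCompletion I
  have hcomp' : IsAdicComplete (IsLocalRing.maximalIdeal R) R := by
    rwa [← IsLocalRing.eq_maximalIdeal hmax]
  let π : R →+* ZMod p := (Ideal.Quotient.lift I (πC : C →+* ZMod p) fun a ha => ha).comp
    (AdicCompletion.evalOneₐ I).toRingHom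
  have hπ : π.comp (algebraMap C R) = πC := by
    ext c
    exact congrArg (Ideal.Quotient.lift I (πC : C →+* ZMod p) fun a ha => ha)
      ((AdicCompletion.evalOneₐ I).commutes c)
  have hscalar : ∀ c : ℤ_[p], algebraMap C R (algebraMap ℤ_[p] C c) = algebraMap ℤ_[p] R c :=
    fun c => rfl
  refine ⟨{
    R := R
    π := π
    ρ := (Matrix.GeneralLinearGroup.map (algebraMap C R)).comp ρC
    isLifting := by
      rw [IsLifting, ← MonoidHom.comp_assoc, ← Matrix.GeneralLinearGroup.map_comp, hπ, hπC]
    universal := fun A _ _ _ _ πA ρA hρA => ?_ }⟩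
  obtain ⟨φ₀, hφ₀, hφ₀'⟩ := hC A ρA
  obtain ⟨N, hN⟩ := (isArtinianRing_iff_isNilpotent_maximalIdeal A).1 inferInstance
  -- Both maps classify `ρbar`, so they agree. Hence `φ₀` sends `I` into the maximal ideal of `A`
  -- and kills `I ^ N`, and so it extends to the completion through `C ⧸ I ^ N`.
  have hres : πA.comp (φ₀ : C →+* A) = πC := by
    let πA' : A →ₐ[ℤ_[p]] ZMod p :=
      { πA with
        commutes' := fun c => RingHom.congr_fun (padicInt_ringHom_ext
          (πA.comp (algebraMap ℤ_[p] A))) c }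
    have h := hπC' (πA'.comp φ₀) (by
      change (Matrix.GeneralLinearGroup.map (πA.comp (φ₀ : C →+* A))).comp ρC = ρbar
      rw [Matrix.GeneralLinearGroup.map_comp, MonoidHom.comp_assoc, hφ₀]
      exact hρA)
    rw [← h]
    rfl
  have hIA : I.map (φ₀ : C →+* A) ≤ IsLocalRing.maximalIdeal A := by
    rw [Ideal.map_le_iff_le_comap, ← ker_eq_maximalIdeal πA]
    intro c hc
    exact (RingHom.congr_fun hres c).trans hc
  have hIN : (I ^ N).map (φ₀ : C →+* A) = ⊥ := by
    rw [Ideal.map_pow, eq_bot_iff]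
    exact (Ideal.pow_right_mono hIA N).trans hN.le
  have hkill : ∀ a ∈ I ^ N, φ₀ a = 0 := fun a ha => by
    have := Ideal.mem_map_of_mem (φ₀ : C →+* A) ha
    rwa [hIN] at this
  let φ : R →ₐ[ℤ_[p]] A :=
    { (Ideal.Quotient.lift (I ^ N) (φ₀ : C →+* A) hkill).comp
        (AdicCompletion.evalₐ I N).toRingHom with
      commutes' := fun c => by
        rw [← hscalar]
        exact (congrArg (Ideal.Quotient.lift (I ^ N) (φ₀ : C →+* A) hkill)
          ((AdicCompletion.evalₐ I N).commutes _)).trans (φ₀.commutes c) }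
  have hφ : (φ : R →+* A).comp (algebraMap C R) = φ₀ := by
    ext c
    exact congrArg (Ideal.Quotient.lift (I ^ N) (φ₀ : C →+* A) hkill)
      ((AdicCompletion.evalₐ I N).commutes c)
  refine ⟨φ, ?_, fun ψ hψ => ?_⟩
  · change (Matrix.GeneralLinearGroup.map (φ : R →+* A)).comp _ = _
    rw [← MonoidHom.comp_assoc, ← Matrix.GeneralLinearGroup.map_comp, hφ, hφ₀]
  · have hψ' : (ψ : R →+* A).comp (algebraMap C R) = φ₀ := by
      let ψ₀ : C →ₐ[ℤ_[p]] A :=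
        { (ψ : R →+* A).comp (algebraMap C R) with
          commutes' := fun c => ψ.commutes c }
      have h := hφ₀' ψ₀ (by
        change (Matrix.GeneralLinearGroup.map ((ψ : R →+* A).comp (algebraMap C R))).comp ρC = ρA
        rw [Matrix.GeneralLinearGroup.map_comp, MonoidHom.comp_assoc]
        exact hψ)
      rw [← h]
      rfl
    ext z
    obtain ⟨c, hc⟩ := Ideal.Quotient.mk_surjective (AdicCompletion.evalₐ I N z)
    -- For uniqueness, `z` is approximated by an element of `C` modulo the extension of `I ^ N`,
    -- which every extension of `φ₀` kills.
    have hz : z - algebraMap C R c ∈ (I ^ N).map (algebraMap C R) := by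
      have h1 : z - algebraMap C R c ∈ LinearMap.ker (AdicCompletion.eval I C N) := by
        have h2 : AdicCompletion.evalₐ I N (z - algebraMap C R c) = 0 := by
          rw [map_sub, AlgHom.commutes, ← hc]
          exact sub_self _
        rw [LinearMap.mem_ker, ← AdicCompletion.factor_evalₐ_eq_eval I _ (by simp), h2, map_zero]
      rw [← AdicCompletion.pow_smul_top_eq_ker_eval hfg, Ideal.smul_top_eq_map] at h1
      exact h1
    have key : ∀ θ : R →ₐ[ℤ_[p]] A, (θ : R →+* A).comp (algebraMap C R) = φ₀ → θ z = φ₀ c := by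
      intro θ hθ
      have h1 := Ideal.mem_map_of_mem (θ : R →+* A) hz
      rw [Ideal.map_map, hθ, hIN, Ideal.mem_bot, map_sub, sub_eq_zero] at h1
      exact h1.trans (RingHom.congr_fun hθ c)
    rw [key ψ hψ', key φ hφ]

end

/-! ### Comparison of the universal rings -/

section

section

variable {A B C G : Type} [CommRing A] [CommRing B] [CommRing C] [Group G] {d : ℕ}
  {D : Determinant A G d} {D' : Determinant B G d} {D'' : Determinant C G d} {φ : A →+* B}
  {ψ : B →+* C}

theorem Determinant.IsBaseChange.comp (h : D.IsBaseChange φ D') (h' : D'.IsBaseChange ψ D'') :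
    D.IsBaseChange (ψ.comp φ) D'' := fun S _ f x => by
  rw [h', h, RingHom.comp_assoc]

theorem Determinant.IsBaseChange.of_comp (h : D.IsBaseChange φ D')
    (h' : D.IsBaseChange (ψ.comp φ) D'') : D'.IsBaseChange ψ D'' := fun S _ f x => by
  rw [h', h, RingHom.comp_assoc]

end

theorem Determinant.IsBaseChange.algHom_comp {K A B C G : Type} [CommRing K] [CommRing A]
    [CommRing B] [CommRing C] [Algebra K A] [Algebra K B] [Algebra K C] [Group G] {d : ℕ}
    {D : Determinant A G d} {D' : Determinant B G d} {D'' : Determinant C G d} {φ : A →ₐ[K] B}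
    {ψ : B →ₐ[K] C} (h : D.IsBaseChange (φ : A →+* B) D') (h' : D'.IsBaseChange (ψ : B →+* C) D'') :
    D.IsBaseChange ((ψ.comp φ : A →ₐ[K] C) : A →+* C) D'' :=
  h.comp h'

/-- Two determinants that specialize to each other and have no proper endomorphisms are
isomorphic. -/
theorem Determinant.exists_algEquiv {K A B G : Type} [CommRing K] [CommRing A] [CommRing B]
    [Algebra K A] [Algebra K B] [Group G] {d : ℕ} {D : Determinant A G d} {D' : Determinant B G d}
    (φ : A →ₐ[K] B) (hφ : D.IsBaseChange (φ : A →+* B) D')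
    (ψ : B →ₐ[K] A) (hψ : D'.IsBaseChange (ψ : B →+* A) D)
    (h : ∀ χ χ' : A →ₐ[K] A, D.IsBaseChange (χ : A →+* A) D → D.IsBaseChange (χ' : A →+* A) D →
      χ = χ')
    (h' : ∀ χ χ' : B →ₐ[K] B, D'.IsBaseChange (χ : B →+* B) D' →
      D'.IsBaseChange (χ' : B →+* B) D' → χ = χ') :
    ∃ e : A ≃ₐ[K] B, D.IsBaseChange (e : A →+* B) D' :=
  ⟨AlgEquiv.ofAlgHom φ ψ (h' _ _ (hψ.algHom_comp hφ) fun _ _ _ _ => rfl)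
    (h _ _ (hφ.algHom_comp hψ) fun _ _ _ _ => rfl), hφ⟩

theorem Determinant.IsBaseChange.trans_algEquiv {K A B C G : Type} [CommRing K] [CommRing A]
    [CommRing B] [CommRing C] [Algebra K A] [Algebra K B] [Algebra K C] [Group G] {d : ℕ}
    {D : Determinant A G d} {D' : Determinant B G d} {D'' : Determinant C G d} {S : Subalgebra K C}
    {e : A ≃ₐ[K] B} (he : D.IsBaseChange (e : A →+* B) D') {e' : B ≃ₐ[K] S}
    (he' : D'.IsBaseChange (S.val.toRingHom.comp (e' : B →+* S)) D'') :
    D.IsBaseChange (S.val.toRingHom.comp ((e.trans e' : A ≃ₐ[K] S) : A →+* S)) D'' := by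
  have hr : S.val.toRingHom.comp ((e.trans e' : A ≃ₐ[K] S) : A →+* S) =
      (S.val.toRingHom.comp (e' : B →+* S)).comp (e : A →+* B) := RingHom.ext fun _ => rfl
  rw [hr]
  exact he.comp he'

/-- An injective homomorphism is an isomorphism to its range. -/
theorem Determinant.IsBaseChange.exists_algEquiv_subalgebra {K A B G : Type} [CommRing K]
    [CommRing A] [CommRing B] [Algebra K A] [Algebra K B] [Group G] {d : ℕ}
    {D : Determinant A G d} {D' : Determinant B G d} {φ : A →ₐ[K] B}
    (h : D.IsBaseChange (φ : A →+* B) D') (hφ : Function.Injective φ) {S : Subalgebra K B}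
    (hS : φ.range = S) :
    ∃ e : A ≃ₐ[K] S, D.IsBaseChange (S.val.toRingHom.comp (e : A →+* S)) D' := by
  subst hS
  exact ⟨AlgEquiv.ofInjective φ hφ, h⟩

theorem eq_of_mk_pow_succ_eq {A : Type} [CommRing A] (I : Ideal A) [IsHausdorff I A] {a b : A}
    (h : ∀ n, Ideal.Quotient.mk (I ^ (n + 1)) a = Ideal.Quotient.mk (I ^ (n + 1)) b) : a = b := by
  refine (IsHausdorff.eq_iff_smodEq (I := I)).2 fun n => ?_
  rw [SModEq.sub_mem, smul_eq_mul, Ideal.mul_top]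
  exact Ideal.pow_le_pow_right n.le_succ ((Ideal.Quotient.mk_eq_mk_iff_sub_mem _ _).1 (h n))

/-- Compatible homomorphisms to the quotients by the powers of an ideal lift to a complete ring. -/
theorem exists_algHom_of_isAdicComplete {K B A : Type} [CommRing K] [CommRing B] [CommRing A]
    [Algebra K B] [Algebra K A] (I : Ideal A) [IsAdicComplete I A]
    (g : ∀ n : ℕ, B →ₐ[K] A ⧸ I ^ (n + 1))
    (hg : ∀ {m n : ℕ} (h : m ≤ n), (Ideal.Quotient.factorₐ K
      (Ideal.pow_le_pow_right (Nat.succ_le_succ h))).comp (g n) = g m) :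
    ∃ φ : B →ₐ[K] A, ∀ n, (Ideal.Quotient.mkₐ K (I ^ (n + 1))).comp φ = g n := by
  -- The given maps start at exponent one, since the quotient by the zeroth power is zero and so not
  -- local. The reindexed family includes that zero quotient.
  let f : (n : ℕ) → B →ₐ[K] A ⧸ I ^ n := fun n =>
    (Ideal.Quotient.factorₐ K (Ideal.pow_le_pow_right n.le_succ)).comp (g n)
  have hfg : ∀ n, f (n + 1) = g n := fun n => hg n.le_succ
  have hf : ∀ {m n : ℕ} (hle : m ≤ n),
      (Ideal.Quotient.factorₐ K (Ideal.pow_le_pow_right hle)).comp (f n) = f m := by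
    intro m n hle
    ext x
    simp only [f, AlgHom.comp_apply]
    rw [← hg hle, AlgHom.comp_apply]
    obtain ⟨a, ha⟩ := Ideal.Quotient.mk_surjective (g n x)
    rw [← ha]
    rfl
  exact ⟨IsAdicComplete.liftAlgHom I f hf, fun n => by
    rw [IsAdicComplete.mkₐ_comp_liftAlgHom I f hf, hfg]⟩

/-- The universal property of a universal pseudodeformation ring extends from Artinian to complete
Noetherian local algebras. -/
theorem PseudoDeformationRing.existsUnique_algHom {p : ℕ} [Fact p.Prime] {G : Type} [Group G]
    [Fintype G] {Dbar : Determinant (ZMod p) G 2} (P : PseudoDeformationRing p Dbar)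
    {R : Type} [CommRing R] [IsLocalRing R] [IsNoetherianRing R] [Algebra ℤ_[p] R]
    [IsAdicComplete (IsLocalRing.maximalIdeal R) R] (π : R →+* ZMod p) (D : Determinant R G 2)
    (hD : D.IsBaseChange π Dbar) :
    ∃! φ : P.R →ₐ[ℤ_[p]] R, P.D.IsBaseChange (φ : P.R →+* R) D := by
  let I := IsLocalRing.maximalIdeal R
  -- `E n` is the reduction of `D` to an Artinian quotient. Uniqueness of the classifying maps `g n`
  -- makes them compatible, so they lift to `R`.
  choose E hE using fun n : ℕ => D.exists_isBaseChange (Ideal.Quotient.mk (I ^ (n + 1)))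
  have hE' : ∀ n, (E n).IsBaseChange (residueQuotientPow π n) Dbar := fun n =>
    (hE n).of_comp (by rwa [residueQuotientPow_comp])
  have huniv : ∀ n, ∃! φ : P.R →ₐ[ℤ_[p]] R ⧸ I ^ (n + 1),
      P.D.IsBaseChange (φ : P.R →+* R ⧸ I ^ (n + 1)) (E n) := fun n =>
    have := isLocalRing_quotient_pow (A := R) n
    have := isArtinianRing_quotient_pow (A := R) n
    P.universal _ (residueQuotientPow π n) (E n) (hE' n)
  choose g hg hg' using huniv
  obtain ⟨φ, hφ⟩ := exists_algHom_of_isAdicComplete I g fun {m n} h => by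
    refine hg' m _ ?_
    have hc : (E n).IsBaseChange (Ideal.Quotient.factorₐ ℤ_[p] (I := I ^ (n + 1))
        (J := I ^ (m + 1)) (Ideal.pow_le_pow_right (Nat.succ_le_succ h)) :
        R ⧸ I ^ (n + 1) →+* R ⧸ I ^ (m + 1)) (E m) := (hE n).of_comp (hE m)
    exact (hg n).algHom_comp hc
  have hmk : ∀ {a b : R}, (∀ n, Ideal.Quotient.mkₐ ℤ_[p] (I ^ (n + 1)) a =
      Ideal.Quotient.mkₐ ℤ_[p] (I ^ (n + 1)) b) → a = b := fun {a b} h =>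
    eq_of_mk_pow_succ_eq I h
  have hφ' : ∀ n x, Ideal.Quotient.mkₐ ℤ_[p] (I ^ (n + 1)) (φ x) = g n x := fun n x =>
    DFunLike.congr_fun (hφ n) x
  refine ⟨φ, ?_, fun ψ hψ => AlgHom.ext fun x => hmk fun n => ?_⟩
  · refine (P.D.isBaseChange_iff _ _).2 ⟨fun x => hmk fun n => (hφ' n _).trans ?_, fun x => hmk fun n => (hφ' n _).trans ?_⟩
    · exact (((P.D.isBaseChange_iff _ _).1 (hg n)).1 x).trans
        (((D.isBaseChange_iff _ _).1 (hE n)).1 x).symm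
    · exact (((P.D.isBaseChange_iff _ _).1 (hg n)).2 x).trans
        (((D.isBaseChange_iff _ _).1 (hE n)).2 x).symm
  · have hc : D.IsBaseChange (Ideal.Quotient.mkₐ ℤ_[p] (I ^ (n + 1)) : R →+* R ⧸ I ^ (n + 1))
      (E n) := hE n
    rw [hφ', ← hg' n _ (hψ.algHom_comp hc), AlgHom.comp_apply]

section

open DihedralGroup

variable {M : ℕ} [NeZero M]

theorem PseudoDeformationRing.exists_algEquiv_pseudoRing {n : ℕ} (hn : 2 * M = 2 ^ n)
    {D : Determinant (PseudoRing ℤ_[2] M) (DihedralGroup (2 * M)) 2}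
    (hD : PseudoRing.IsUniversalDet D) (P : PseudoDeformationRing 2
      (Determinant.ofRep (1 : DihedralGroup (2 * M) →* GL (Fin 2) (ZMod 2)))) :
    ∃ e : P.R ≃ₐ[ℤ_[2]] PseudoRing ℤ_[2] M,
      P.D.IsBaseChange (e : P.R →+* PseudoRing ℤ_[2] M) D := by
  have := PseudoRing.finite M
  have := PseudoRing.isLocalRing M hn
  have := isNoetherianRing_of_finite 2 (PseudoRing ℤ_[2] M)
  have := isAdicComplete_of_ker_le_radical _ (PseudoRing.ker_residue_le M hn)
  obtain ⟨φ, hφ, -⟩ := P.existsUnique_algHom (PseudoRing.residue M) D (by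
    let _ : Algebra ℤ_[2] (ZMod 2) := PadicInt.toZMod.toAlgebra
    exact PseudoRing.isBaseChange_ofDet hD _)
  exact Determinant.exists_algEquiv φ hφ (PseudoRing.ofDet P.D)
    (PseudoRing.isBaseChange_ofDet hD P.D)
    (fun χ χ' h h' => (P.existsUnique_algHom P.π P.D P.isDeformation).unique h h')
    (fun χ χ' h h' => (PseudoRing.algHom_eq_ofDet hD D χ h).trans
      (PseudoRing.algHom_eq_ofDet hD D χ' h').symm)

theorem LiftingRing.ofDet_injective {n : ℕ} (hn : 2 * M = 2 ^ n)
    (L : LiftingRing 2 (1 : DihedralGroup (2 * M) →* GL (Fin 2) (ZMod 2))) :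
    Function.Injective (PseudoRing.ofDet (R := ℤ_[2]) (Determinant.ofRep L.ρ)) := by
  have := finite_testRing M
  have := isLocalRing_testRing M hn
  have := isNoetherianRing_of_finite 2 (TestRing ℤ_[2] M)
  rw [injective_iff_map_eq_zero]
  intro f hf
  refine PseudoRing.eq_zero_of_ofDet (residueTestRing M) (residueTestRing_root M) f
    fun ρ hρ => ?_
  let I := IsLocalRing.maximalIdeal (TestRing ℤ_[2] M)
  have key : ∀ k, Ideal.Quotient.mk (I ^ (k + 1))
      (PseudoRing.ofDet (R := ℤ_[2]) (Determinant.ofRep ρ) f) = 0 := by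
    intro k
    have := isLocalRing_quotient_pow (A := TestRing ℤ_[2] M) k
    have := isArtinianRing_quotient_pow (A := TestRing ℤ_[2] M) k
    obtain ⟨ψ, hψ, -⟩ := L.universal _ (residueQuotientPow (residueTestRing M) k)
      ((Matrix.GeneralLinearGroup.map (Ideal.Quotient.mk (I ^ (k + 1)))).comp ρ) (by
        rw [IsLifting, ← MonoidHom.comp_assoc, ← Matrix.GeneralLinearGroup.map_comp,
          residueQuotientPow_comp]
        exact hρ)
    have hc := Determinant.isBaseChange_ofRep
      (ψ : L.R →+* TestRing ℤ_[2] M ⧸ I ^ (k + 1)) L.ρ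
    rw [hψ] at hc
    have h1 := PseudoRing.comp_ofDet ψ _ _ hc
    have h2 := PseudoRing.comp_ofDet (Ideal.Quotient.mkₐ ℤ_[2] (I ^ (k + 1))) _ _
      (Determinant.isBaseChange_ofRep (Ideal.Quotient.mk (I ^ (k + 1))) ρ)
    refine (DFunLike.congr_fun (h2.trans h1.symm) f).trans ?_
    rw [AlgHom.comp_apply, hf, map_zero]
  exact eq_of_mk_pow_succ_eq I fun k => (key k).trans (map_zero _).symm

theorem LiftingRing.range_ofDet
    {D : Determinant (PseudoRing ℤ_[2] M) (DihedralGroup (2 * M)) 2}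
    (hD : PseudoRing.IsUniversalDet D)
    (L : LiftingRing 2 (1 : DihedralGroup (2 * M) →* GL (Fin 2) (ZMod 2))) :
    (PseudoRing.ofDet (R := ℤ_[2]) (Determinant.ofRep L.ρ)).range = L.coeffRing := by
  set κ := PseudoRing.ofDet (R := ℤ_[2]) (Determinant.ofRep L.ρ) with hκ
  have hκc := PseudoRing.ofDet_coord (R := ℤ_[2]) (Determinant.ofRep L.ρ)
  have hchar : ∀ g, (L.ρ g : Matrix (Fin 2) (Fin 2) L.R).charpoly =
      Polynomial.X ^ 2 - Polynomial.C ((Determinant.ofRep L.ρ).tr g) * Polynomial.X +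
        Polynomial.C ((Determinant.ofRep L.ρ).nm g) := fun g => by
    rw [Matrix.charpoly_fin_two, Determinant.tr_ofRep, Determinant.nm_ofRep]
  apply le_antisymm
  · rw [← Algebra.map_top, ← PseudoRing.adjoin_coord, AlgHom.map_adjoin, Algebra.adjoin_le_iff]
    have htr : ∀ g, (Determinant.ofRep L.ρ).tr g ∈ L.coeffRing := fun g => by
      rw [← neg_mem_iff]
      refine Algebra.subset_adjoin ⟨g, 1, ?_⟩
      rw [hchar]
      simp [Polynomial.coeff_X_pow]
    have hnm : ∀ g, (Determinant.ofRep L.ρ).nm g ∈ L.coeffRing := fun g => by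
      refine Algebra.subset_adjoin ⟨g, 0, ?_⟩
      rw [hchar]
      simp
    rintro _ ⟨_, ⟨i, rfl⟩, rfl⟩
    rw [SetLike.mem_coe]
    refine (hκc i).symm ▸ ?_
    fin_cases i
    exacts [htr _, htr _, htr _, hnm _, hnm _]
  · refine Algebra.adjoin_le ?_
    rintro _ ⟨g, i, rfl⟩
    obtain ⟨ht, hn⟩ := (D.isBaseChange_iff _ _).1
      (PseudoRing.isBaseChange_ofDet hD (Determinant.ofRep L.ρ))
    refine ⟨(Polynomial.X ^ 2 - Polynomial.C (D.tr g) * Polynomial.X +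
      Polynomial.C (D.nm g)).coeff i, (Polynomial.coeff_map _ _).symm.trans ?_⟩
    rw [hchar, ← ht, ← hn]
    simp
    rfl

end

end

end PseudoDef

end

theorem mainTheorem4 (m : ℕ) (hm : 2 ≤ m) (hpow : ∃ n : ℕ, m = 2 ^ n)
    (ρbar : DihedralGroup m →* GL (Fin 2) (ZMod 2)) (hρbar : ρbar = 1) :
    Nonempty (PseudoDef.PseudoDeformationRing 2 (PseudoDef.Determinant.ofRep ρbar)) ∧
    Nonempty (PseudoDef.LiftingRing 2 ρbar) ∧
    ∀ (P : PseudoDef.PseudoDeformationRing 2 (PseudoDef.Determinant.ofRep ρbar))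
      (L : PseudoDef.LiftingRing 2 ρbar),
      (∃ e : P.R ≃ₐ[ℤ_[2]] L.coeffRing,
        P.D.IsBaseChange (L.coeffRing.val.toRingHom.comp (e : P.R →+* L.coeffRing))
          (PseudoDef.Determinant.ofRep L.ρ)) ∧
      ∃ s : ℕ, 0 < s ∧ 2 * s = m + 18 ∧
        Nonempty (P.R ≃ₗ[ℤ_[2]] (Fin s → ℤ_[2])) ∧
        Nonempty (L.coeffRing ≃ₗ[ℤ_[2]] (Fin s → ℤ_[2])) := by
  obtain ⟨n, hn⟩ := hpow
  obtain ⟨k, rfl⟩ : ∃ k, n = k + 1 := Nat.exists_eq_succ_of_ne_zero (by rintro rfl; omega)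
  obtain ⟨M, rfl⟩ : ∃ M, m = 2 * M := ⟨2 ^ k, by rw [hn, pow_succ']⟩
  have : NeZero M := ⟨by omega⟩
  subst hρbar
  obtain ⟨D, hD⟩ := PseudoDef.PseudoRing.exists_determinant (PseudoDef.residueTestRing M)
    (PseudoDef.residueTestRing_root M)
  obtain ⟨l⟩ := PseudoDef.PseudoRing.exists_linearEquiv (PseudoDef.residueTestRing M)
    (PseudoDef.residueTestRing_root M)
  refine ⟨PseudoDef.exists_pseudoDeformationRing M hn, PseudoDef.exists_liftingRing 1,
    fun P L => ?_⟩
  obtain ⟨e₁, he₁⟩ := P.exists_algEquiv_pseudoRing hn hD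
  obtain ⟨e₂, he₂⟩ := (PseudoDef.PseudoRing.isBaseChange_ofDet hD
    (PseudoDef.Determinant.ofRep L.ρ)).exists_algEquiv_subalgebra (L.ofDet_injective hn)
    (L.range_ofDet hD)
  exact ⟨⟨e₁.trans e₂, he₁.trans_algEquiv he₂⟩, M + 9, by omega, by omega,
    ⟨e₁.toLinearEquiv.trans l⟩, ⟨e₂.symm.toLinearEquiv.trans l⟩⟩
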